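/- **Setting.** Let $\Theta_1,\Theta_2,\dots$ be i.i.d. real random variables whose law has a bounded density with respect to Lebesgue measure and has finite mean and variance. For every stage $p\ge 1$ let $\sigma_{1p},\dots,\sigma_{pp}>0$ be i.i.d. with law $h_p$ of finite mean $\mathbb E(\sigma_{ip})$, independent of the $\Theta_i$; given all these, the observations $X_{1p},\dots,X_{pp}$ are independent and $X_{ip}$ has law $g(\Theta_i,\sigma_{ip})$. Here $(g(\theta,\sigma))_{\theta\in\mathbb R,\sigma>0}$ is a family of laws with mean $\theta$ and variance $\sigma^2$, having jointly measurable densities $x\mapsto L(x;\theta,\sigma)$ with respect to a fixed $\sigma$-finite measure. Assume that there is a constant $K$ such that for all $x$ and all $\sigma>0$ the function $\theta\mapsto L(x;\theta,\sigma)$ is integrable and $$\int_{-\infty}^{\infty}\bigl(K\sigma^2-(\theta-x)^2\bigr)L(x;\theta,\sigma)\,d\theta>0 .$$ Let $\Theta_{L;x,\sigma}$ denote a random variable with density proportional to $\theta\mapsto L(x;\theta,\sigma)$. **Loss functions.** A pairwise loss is a function $l(x,y)$ that is $0$ if $x\ge y$ and positive if $x<y$. It is *restrained* if it is (weakly) increasing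 in $y$ and decreasing in $x$, there is $\lambda$ such that $l$ is $\lambda$-Lipschitz on $\{x<y\}$, there are $a,b>0$ with $l(x,y)>b(y-x)$ whenever $x<y<x+a$, and there is $D$ with $l(x,x+\epsilon)<D+\lambda\epsilon$ for all $x$ and all $\epsilon>0$. For $s(p)>0$, a sequence of measurable functions $L_p:\mathbb R^p\to\mathbb R$ is a *regular loss with scaling $s$* if there are a restrained pairwise loss $l$ and constants $0<c<u$ such that for all $p\ge1$ and all $y\in\mathbb R^p$ $$c\,L_p(y)\le s(p)\sum_{i<j}l(y_i,y_j)\le u\,L_p(y).$$ **Ranking methods.** Let $\pi:\mathbb R\to[0,\infty)$ be a measurable prior density (possibly improper), which need not be related to the law of the $\Theta_i$, and let $R_p$ be a regular loss with some scaling $s'$. The *Bayesian ranking* for $\pi$ and $R_p$ is a permutation $\hat\rho_p$ of $\{1,\dots,p\}$ ($\hat\rho_p(i)$ is the rank of unit $i$), depending measurably on the data $(X_{ip},\sigma_{ip})_{i\le p}$, that minimises over all permutations $\rho$ the posterior expected loss $$\mathbb E\bigl(R_p(\vartheta_{\rho^{-1}(1)},\dots,\vartheta_{\rho^{-1}(p)})\bigr),$$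 where $\vartheta_1,\dots,\vartheta_p$ are independent and $\vartheta_i$ has density proportional to $\pi(\theta)L(X_{ip};\theta,\sigma_{ip})$. **Theorem.** Suppose that 1. $s(p)\,p^2\,\bigl(\mathbb E(\sigma_{ip})\bigr)^{1/3}\to0$ as $p\to\infty$; 2. $\pi$ is quasiunimodal: there are $m\in\mathbb R$ and $\epsilon>0$ such that $\pi(x_1)\ge\epsilon\pi(x_2)$ whenever $x_2\le x_1\le m$ or $m\le x_1\le x_2$; 3. $\pi$ is tail-dominating: there are constants $r>0$ and $s_0$ such that for all $\sigma>0$, all $a\ge\sigma$ and all $x\in\mathbb R$ $$\mathbb E\Bigl(\bigl((\Theta_{L;x,\sigma}-x)^2-a^2\bigr)_+\Bigr)<s_0\,\sigma a\,\min\Bigl\{\pi\Bigl(\frac{ra}{\sigma}\Bigr),\pi\Bigl(-\frac{ra}{\sigma}\Bigr)\Bigr\}.$$ Then every Bayesian ranking $\hat\rho_p$ for $\pi$ and $R_p$ is consistent with respect to every regular loss $L_p$ with scaling $s$, that is, $$\mathbb E\Bigl(L_p\bigl(\Theta_{\hat\rho_p^{-1}(1)},\dots,\Theta_{\hat\rho_p^{-1}(p)}\bigr)\Bigr)\longrightarrow0\qquad(p\to\infty).$$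 In particular both the prior $\pi$ and the loss $R_p$ used by the method may be misspecified. -/

import Mathlib

open MeasureTheory ProbabilityTheory Filter Topology
open scoped ENNReal NNReal

namespace Ranking

noncomputable section

/-! ### Error distributions and likelihoods

A likelihood is a function `L x θ σ` of the observation `x`, the true value `θ` and the
standard deviation `σ`. -/

/-- `g (θ, σ)` is the law of an observation with true value `θ` and standard deviation `σ > 0`:
it has mean `θ`, variance `σ ^ 2`, and density `x ↦ L x θ σ` with respect to a fixed reference
measure `ν`. -/
structure IsErrorModel (g : Kernel (ℝ × ℝ) ℝ) (ν : Measure ℝ) (L : ℝ → ℝ → ℝ → ℝ) : Prop where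
  measurable : Measurable fun z : ℝ × ℝ × ℝ => L z.1 z.2.1 z.2.2
  nonneg : ∀ x θ σ, 0 ≤ L x θ σ
  density : ∀ θ σ, 0 < σ → g (θ, σ) = ν.withDensity fun x => ENNReal.ofReal (L x θ σ)
  memLp : ∀ θ σ, 0 < σ → MemLp id 2 (g (θ, σ))
  mean : ∀ θ σ, 0 < σ → ∫ x, x ∂g (θ, σ) = θ
  variance : ∀ θ σ, 0 < σ → ∫ x, (x - θ) ^ 2 ∂g (θ, σ) = σ ^ 2

/-- The regularity assumption on the conditional distribution: as functions of `θ`, the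
likelihoods are integrable, with second moment about `x` less than `K * σ ^ 2` after
normalisation, where `K` does not depend on `x` and `σ`. (If `(θ - x) ^ 2 * L x θ σ` is not
integrable, the Bochner integral below is `0` and the condition fails.) -/
def RegularLikelihood (L : ℝ → ℝ → ℝ → ℝ) : Prop :=
  ∃ K : ℝ, ∀ σ, 0 < σ → ∀ x,
    Integrable (fun θ => L x θ σ) ∧ 0 < ∫ θ, (K * σ ^ 2 - (θ - x) ^ 2) * L x θ σ

/-- The posterior distribution of the true value of a unit given the observation `x` with standard
deviation `σ`, under the prior density `π`: its density is proportional to `π θ * L x θ σ`. -/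
def posterior (π : ℝ → ℝ) (L : ℝ → ℝ → ℝ → ℝ) (x σ : ℝ) : Measure ℝ :=
  ((volume.withDensity fun θ => ENNReal.ofReal (π θ * L x θ σ)) Set.univ)⁻¹ •
    volume.withDensity fun θ => ENNReal.ofReal (π θ * L x θ σ)

/-- The law of `Θ_{L; x, σ}`: the posterior under the improper uniform prior. -/
def likelihoodLaw (L : ℝ → ℝ → ℝ → ℝ) (x σ : ℝ) : Measure ℝ :=
  posterior (fun _ => 1) L x σ

/-! ### Priors -/

/-- `π` is quasiunimodal: up to a constant factor, it decreases away from a quasimode `m`. -/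
def Quasiunimodal (π : ℝ → ℝ) : Prop :=
  ∃ m ε : ℝ, 0 < ε ∧
    (∀ x₁ x₂, x₂ ≤ x₁ → x₁ ≤ m → ε * π x₂ ≤ π x₁) ∧
    (∀ x₁ x₂, m ≤ x₁ → x₁ ≤ x₂ → ε * π x₂ ≤ π x₁)

/-- `π` is tail-dominating for the likelihood `L`:
`E ((Θ_{L; x, σ} - x) ^ 2 - a ^ 2)₊ < s σ a π (± r a / σ)` for all `x` and all `a ≥ σ > 0`. -/
def TailDominating (π : ℝ → ℝ) (L : ℝ → ℝ → ℝ → ℝ) : Prop :=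
  ∃ r s : ℝ, 0 < r ∧ ∀ σ, 0 < σ → ∀ a, σ ≤ a → ∀ x,
    ∫⁻ θ, ENNReal.ofReal ((θ - x) ^ 2 - a ^ 2) ∂likelihoodLaw L x σ
        < ENNReal.ofReal (s * σ * a * π (r * a / σ)) ∧
    ∫⁻ θ, ENNReal.ofReal ((θ - x) ^ 2 - a ^ 2) ∂likelihoodLaw L x σ
        < ENNReal.ofReal (s * σ * a * π (-(r * a / σ)))

/-- `μ` is absolutely continuous with bounded density. -/
def HasBoundedDensity (μ : Measure ℝ) : Prop :=
  ∃ (f : ℝ → ℝ) (C : ℝ), Measurable f ∧ (∀ x, 0 ≤ f x ∧ f x ≤ C) ∧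
    μ = volume.withDensity fun x => ENNReal.ofReal (f x)

/-! ### Loss functions

A sequence of loss functions is `M : (p : ℕ) → (Fin p → ℝ) → ℝ`; the value `M p y` is the loss of
a ranking of `p` units that puts the units in an order in which their true values are
`y 0, y 1, …, y (p - 1)`, first-ranked unit first. Only the stages `p ≥ 1` matter. -/

/-- `l` is a pairwise loss function. -/
def IsPairwiseLoss (l : ℝ → ℝ → ℝ) : Prop :=
  (∀ x y, y ≤ x → l x y = 0) ∧ ∀ x y, x < y → 0 < l x y

/-- `l` is restrained. -/
def Restrained (l : ℝ → ℝ → ℝ) : Prop :=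
  (∀ x, Monotone fun y => l x y) ∧ (∀ y, Antitone fun x => l x y) ∧
  ∃ (lam : ℝ≥0),
    LipschitzOnWith lam (fun z : ℝ × ℝ => l z.1 z.2) {z | z.1 < z.2} ∧
    (∃ a b : ℝ, 0 < a ∧ 0 < b ∧ ∀ x y, x < y → y < x + a → b * (y - x) < l x y) ∧
    (∃ D : ℝ, ∀ x ε, 0 < ε → l x (x + ε) < D + lam * ε)

/-- The additive loss function generated by `l`, with scaling `s`. -/
def additiveLoss (s : ℕ → ℝ) (l : ℝ → ℝ → ℝ) (p : ℕ) (y : Fin p → ℝ) : ℝ :=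
  s p * ∑ i, ∑ j ∈ Finset.Ioi i, l (y i) (y j)

/-- Equivalence of sequences of loss functions. -/
def LossEquivalent (M N : (p : ℕ) → (Fin p → ℝ) → ℝ) : Prop :=
  ∃ c u : ℝ, 0 < c ∧ c < u ∧ ∀ p, 1 ≤ p → ∀ y, c * M p y ≤ N p y ∧ N p y ≤ u * M p y

/-- `M` is regular with scaling `s`: it is a sequence of (Borel) loss functions equivalent to the
additive loss with scaling `s` generated by some restrained pairwise loss. -/
def RegularLoss (s : ℕ → ℝ) (M : (p : ℕ) → (Fin p → ℝ) → ℝ) : Prop :=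
  (∀ p, 1 ≤ p → 0 < s p) ∧ (∀ p, Measurable (M p)) ∧
  ∃ l, IsPairwiseLoss l ∧ Restrained l ∧ LossEquivalent M (additiveLoss s l)

/-! ### Rankings

A ranking of `p` units is a permutation `ρ` of `Fin p`; unit `i` gets rank `ρ i`, and `ρ.symm k` is
the unit with rank `k`. -/

/-- The posterior expectation of the (nonnegative) loss `M p` of the ranking `ρ`, given the
observations `x` with standard deviations `σ`: the true values of the units are independent under
the posterior. -/
def posteriorLoss (π : ℝ → ℝ) (L : ℝ → ℝ → ℝ → ℝ) (M : (p : ℕ) → (Fin p → ℝ) → ℝ) {p : ℕ}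
    (x σ : Fin p → ℝ) (ρ : Equiv.Perm (Fin p)) : ℝ≥0∞ :=
  ∫⁻ θ, ENNReal.ofReal (M p fun k => θ (ρ.symm k))
    ∂Measure.pi fun i => posterior π L (x i) (σ i)

/-- `ρ` is a Bayesian ranking for the loss `M` and the prior `π`: a measurable function of the
data `x`, `σ` that minimises the posterior expected loss. -/
def IsBayesianRanking (π : ℝ → ℝ) (L : ℝ → ℝ → ℝ → ℝ) (M : (p : ℕ) → (Fin p → ℝ) → ℝ)
    (ρ : (p : ℕ) → (Fin p → ℝ) → (Fin p → ℝ) → Equiv.Perm (Fin p)) : Prop :=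
  (∀ p τ, MeasurableSet {z : (Fin p → ℝ) × (Fin p → ℝ) | ρ p z.1 z.2 = τ}) ∧
  ∀ p, 1 ≤ p → ∀ x σ : Fin p → ℝ, (∀ i, 0 < σ i) → ∀ τ : Equiv.Perm (Fin p),
    posteriorLoss π L M x σ (ρ p x σ) ≤ posteriorLoss π L M x σ τ

/-- The random data: a fixed sequence `Θ` of true values and, at each stage `p`, standard deviations
`σ p i` and observations `X p i` for `i < p`. At each stage the triples of the units are i.i.d.;
in each triple, `Θ i` has law `μ`, `σ p i` has law `h p` and is independent of `Θ i`, and the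
conditional law of `X p i` given these two is `g (Θ i, σ p i)`. -/
structure IsRankingSample {Ω : Type*} [MeasurableSpace Ω] (P : Measure Ω) (μ : Measure ℝ)
    (h : ℕ → Measure ℝ) (g : Kernel (ℝ × ℝ) ℝ)
    (Θ : ℕ → Ω → ℝ) (σ X : (p : ℕ) → Fin p → Ω → ℝ) : Prop where
  measurable_Θ : ∀ i, Measurable (Θ i)
  measurable_σ : ∀ p i, Measurable (σ p i)
  measurable_X : ∀ p i, Measurable (X p i)
  indep : ∀ p, iIndepFun (fun (i : Fin p) ω => ((Θ i ω, σ p i ω), X p i ω)) P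
  law : ∀ p (i : Fin p),
    P.map (fun ω => ((Θ i ω, σ p i ω), X p i ω)) = (μ.prod (h p)) ⊗ₘ g

/-- Consistency of the ranking method `ρ` with respect to the loss functions `M`: the expected loss
of the estimated ranking tends to `0`. -/
def Consistent {Ω : Type*} [MeasurableSpace Ω] (P : Measure Ω)
    (Θ : ℕ → Ω → ℝ) (σ X : (p : ℕ) → Fin p → Ω → ℝ) (M : (p : ℕ) → (Fin p → ℝ) → ℝ)
    (ρ : (p : ℕ) → (Fin p → ℝ) → (Fin p → ℝ) → Equiv.Perm (Fin p)) : Prop :=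
  Tendsto (fun p : ℕ => ∫⁻ ω, ENNReal.ofReal
      (M p fun k => Θ ((ρ p (fun i => X p i ω) (fun i => σ p i ω)).symm k) ω) ∂P)
    atTop (𝓝 0)

end

end Ranking

/-!
The argument rests on a comparison of the Bayesian ranking with an explicit one.

*The posterior.* Quasiunimodality and tail domination make the posterior of a unit concentrate at
its observation (`exists_concentrated_posterior`), in two senses. Its root mean square deviation
from `x` is `O(σ (1 + |x| + σ))`: at distances of this order, tail domination makes the likelihood so
small that even the smallest prior weight near `x` outweighs it. This quantity need not be
integrable, as only `σ` has finite mean; but on at least one side the mean deviation is `O(σ)`,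
since in the direction away from the quasimode the prior cannot inflate the likelihood.

*The comparison ranking.* A unit with `σ ≤ 1` is scored by its observation, any other unit by its
observation shifted to the far end of the side on which its posterior may be spread out, and units
are ranked by score. In this ranking a long deviation of one unit is costly only against units that
are at least as spread out, so the posterior loss of a pair is bounded by `pairBound`
(`Concentrated.pair_loss_le`): a Chebyshev estimate if both `σ ≤ 1`, and otherwise a product of the
sizes of the two units.

*Near-optimality.* The loss `R` is merely equivalent to an additive one, hence only the total
posterior loss of the Bayesian ranking is controlled, by a constant times that of the comparison
ranking (`IsBayesianRanking.sum_lintegral_le`). The function `min t a` of the gap `t` bounds the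
pairwise loss from below and is `1`-Lipschitz, so the sum of `min t a` over the pairs whose true
values are misranked is bounded by the same quantity, up to the fluctuations of the units. For a
threshold `η`, the loss of misranking a gap `t` is in turn at most a constant times
`1_{t < η} + η t ^ 2 + min t a / η` (`one_add_le_of_scale`).

*Expectations.* Let `m` be the mean of `σ`. The expected fluctuations and the expected pair bound
are `O(m)`; for the Chebyshev estimate this uses the bounded density of the true values, against
which the Cauchy kernel of scale `t` integrates to `O(t)` (`lintegral_reversalBound_le`). Hence the
expected additive loss per pair is `O(η + m / η)`, and `η = m ^ (1 / 3)` suffices.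
-/

namespace Ranking

/-! ### Priors and reweighted measures -/

/-- The probability measure whose density with respect to `q` is proportional to `π`. -/
noncomputable def reweight (q : Measure ℝ) (π : ℝ → ℝ) : Measure ℝ :=
  (∫⁻ θ, ENNReal.ofReal (π θ) ∂q)⁻¹ • q.withDensity fun θ => ENNReal.ofReal (π θ)

theorem lintegral_reweight (q : Measure ℝ) {π : ℝ → ℝ} (hπ : Measurable π) (f : ℝ → ℝ≥0∞) :
    ∫⁻ θ, f θ ∂reweight q π =
      (∫⁻ θ, ENNReal.ofReal (π θ) ∂q)⁻¹ * ∫⁻ θ, ENNReal.ofReal (π θ) * f θ ∂q := by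
  rw [reweight, lintegral_smul_measure,
    lintegral_withDensity_eq_lintegral_mul_non_measurable _ hπ.ennreal_ofReal
      (by simp)]
  rfl

theorem lintegral_reweight_le {q : Measure ℝ} {π : ℝ → ℝ} (hπ : Measurable π) {f : ℝ → ℝ≥0∞}
    {y z c : ℝ} (hc : 0 ≤ c) (hz : ENNReal.ofReal z ≤ ∫⁻ θ, ENNReal.ofReal (π θ) ∂q)
    (hy : ∫⁻ θ, ENNReal.ofReal (π θ) * f θ ∂q ≤ ENNReal.ofReal y) (hyz : y ≤ c * z) :
    ∫⁻ θ, f θ ∂reweight q π ≤ ENNReal.ofReal c := by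
  rw [lintegral_reweight q hπ, mul_comm, ← div_eq_mul_inv]
  refine ENNReal.div_le_of_le_mul (hy.trans ?_)
  refine (ENNReal.ofReal_le_ofReal hyz).trans ?_
  rw [ENNReal.ofReal_mul hc]
  gcongr

/-- Bayes' theorem with the likelihood law as reference measure. -/
theorem posterior_eq_reweight {π : ℝ → ℝ} {L : ℝ → ℝ → ℝ → ℝ} (hπ : Measurable π)
    (hπ0 : ∀ θ, 0 ≤ π θ) {x σ : ℝ} (hL : Measurable fun θ => L x θ σ)
    (hI0 : (∫⁻ θ, ENNReal.ofReal (L x θ σ)) ≠ 0) (hI : (∫⁻ θ, ENNReal.ofReal (L x θ σ)) ≠ ∞) :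
    posterior π L x σ = reweight (likelihoodLaw L x σ) π := by
  have e : (volume.withDensity fun θ => ENNReal.ofReal (π θ * L x θ σ)) =
      (volume.withDensity fun θ => ENNReal.ofReal (L x θ σ)).withDensity
        fun θ => ENNReal.ofReal (π θ) := by
    rw [← withDensity_mul _ hL.ennreal_ofReal hπ.ennreal_ofReal]
    congr 1
    ext θ
    simp [ENNReal.ofReal_mul (hπ0 θ), mul_comm]
  have hu : (volume.withDensity fun θ => ENNReal.ofReal (L x θ σ)) Set.univ =
      ∫⁻ θ, ENNReal.ofReal (L x θ σ) := by simp
  rw [likelihoodLaw, posterior, posterior, reweight, e]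
  simp only [one_mul, hu]
  set I := ∫⁻ θ, ENNReal.ofReal (L x θ σ)
  set ℓ := volume.withDensity fun θ => ENNReal.ofReal (L x θ σ)
  rw [withDensity_smul_measure, lintegral_smul_measure, smul_smul]
  congr 1
  rw [smul_eq_mul, ENNReal.mul_inv (Or.inl (by simp [hI])) (Or.inl (by simp [hI0])), inv_inv,
    mul_right_comm, ENNReal.mul_inv_cancel hI0 hI, one_mul]
  simp

/-- The likelihood law is a probability measure with second moment about `x` of order `σ ^ 2`. -/
theorem likelihoodLaw_moment {L : ℝ → ℝ → ℝ → ℝ}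
    (hm : Measurable fun z : ℝ × ℝ × ℝ => L z.1 z.2.1 z.2.2) (h0 : ∀ x θ σ, 0 ≤ L x θ σ)
    (hL : RegularLikelihood L) :
    ∃ K : ℝ, 0 ≤ K ∧ ∀ σ, 0 < σ → ∀ x,
      (∫⁻ θ, ENNReal.ofReal (L x θ σ)) ≠ 0 ∧ (∫⁻ θ, ENNReal.ofReal (L x θ σ)) ≠ ∞ ∧
      IsProbabilityMeasure (likelihoodLaw L x σ) ∧
      ∫⁻ θ, ENNReal.ofReal ((θ - x) ^ 2) ∂likelihoodLaw L x σ ≤ ENNReal.ofReal (K * σ ^ 2) := by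
  obtain ⟨K, hK⟩ := hL
  have key : ∀ σ, 0 < σ → ∀ x, 0 < ∫ θ, L x θ σ ∧ Integrable (fun θ => (θ - x) ^ 2 * L x θ σ) ∧
      ∫ θ, (θ - x) ^ 2 * L x θ σ < K * σ ^ 2 * ∫ θ, L x θ σ := by
    intro σ hσ x
    obtain ⟨hi, hp⟩ := hK σ hσ x
    have hi1 : Integrable (fun θ => (K * σ ^ 2 - (θ - x) ^ 2) * L x θ σ) := by
      by_contra hn
      rw [integral_undef hn] at hp
      exact lt_irrefl _ hp
    have hi2 : Integrable (fun θ => (θ - x) ^ 2 * L x θ σ) := by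
      have := (hi.const_mul (K * σ ^ 2)).sub hi1
      refine this.congr (ae_of_all _ fun θ => ?_)
      simp only [Pi.sub_apply]
      ring
    have hlt : ∫ θ, (θ - x) ^ 2 * L x θ σ < K * σ ^ 2 * ∫ θ, L x θ σ := by
      have e : ∫ θ, (K * σ ^ 2 - (θ - x) ^ 2) * L x θ σ =
          K * σ ^ 2 * (∫ θ, L x θ σ) - ∫ θ, (θ - x) ^ 2 * L x θ σ := by
        rw [← integral_const_mul, ← integral_sub (hi.const_mul _) hi2]
        simp only [sub_mul]
      linarith
    have hge : 0 ≤ ∫ θ, (θ - x) ^ 2 * L x θ σ :=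
      integral_nonneg fun θ => mul_nonneg (sq_nonneg _) (h0 _ _ _)
    have hIge : 0 ≤ ∫ θ, L x θ σ := integral_nonneg fun θ => h0 _ _ _
    refine ⟨lt_of_le_of_ne hIge fun h => ?_, hi2, hlt⟩
    rw [← h] at hlt
    simp only [mul_zero] at hlt
    exact absurd hlt (not_lt.2 hge)
  have hK0 : 0 ≤ K := by
    obtain ⟨h1, -, h2⟩ := key 1 one_pos 0
    have hge : 0 ≤ ∫ θ, (θ - 0) ^ 2 * L 0 θ 1 :=
      integral_nonneg fun θ => mul_nonneg (sq_nonneg _) (h0 _ _ _)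
    by_contra hn
    nlinarith
  refine ⟨K, hK0, fun σ hσ x => ?_⟩
  obtain ⟨hI, hi2, hlt⟩ := key σ hσ x
  have hi := (hK σ hσ x).1
  have hmθ : Measurable fun θ => L x θ σ := by
    exact hm.comp (by fun_prop : Measurable fun θ : ℝ => ((x, θ, σ) : ℝ × ℝ × ℝ))
  have e1 : ∫⁻ θ, ENNReal.ofReal (L x θ σ) = ENNReal.ofReal (∫ θ, L x θ σ) :=
    (ofReal_integral_eq_lintegral_ofReal hi (ae_of_all _ fun θ => h0 _ _ _)).symm
  have e2 : ∫⁻ θ, ENNReal.ofReal (L x θ σ) * ENNReal.ofReal ((θ - x) ^ 2) =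
      ENNReal.ofReal (∫ θ, (θ - x) ^ 2 * L x θ σ) := by
    rw [ofReal_integral_eq_lintegral_ofReal hi2
      (ae_of_all _ fun θ => mul_nonneg (sq_nonneg _) (h0 _ _ _))]
    refine lintegral_congr fun θ => ?_
    rw [ENNReal.ofReal_mul (sq_nonneg _), mul_comm]
  have hne : (∫⁻ θ, ENNReal.ofReal (L x θ σ)) ≠ 0 := by
    rw [e1]; simpa using hI
  have hnt : (∫⁻ θ, ENNReal.ofReal (L x θ σ)) ≠ ∞ := by rw [e1]; simp
  have hq : likelihoodLaw L x σ = (∫⁻ θ, ENNReal.ofReal (L x θ σ))⁻¹ •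
      volume.withDensity fun θ => ENNReal.ofReal (L x θ σ) := by
    simp [likelihoodLaw, posterior]
  refine ⟨hne, hnt, ⟨?_⟩, ?_⟩
  · rw [hq]
    simp [ENNReal.inv_mul_cancel hne hnt]
  · rw [hq, lintegral_smul_measure, lintegral_withDensity_eq_lintegral_mul_non_measurable _
      hmθ.ennreal_ofReal (by simp), smul_eq_mul, mul_comm, ← div_eq_mul_inv]
    refine ENNReal.div_le_of_le_mul ?_
    simp only [Pi.mul_apply]
    rw [e2, e1, ← ENNReal.ofReal_mul (by positivity)]
    exact ENNReal.ofReal_le_ofReal hlt.le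

/-- The second moment bound shows that at least half of the mass lies within `(K + 1) * σ`
of `x`. -/
theorem half_le_measure_near {q : Measure ℝ} [IsProbabilityMeasure q] {K σ x : ℝ} (hK : 0 ≤ K)
    (hσ : 0 < σ) (h2 : ∫⁻ θ, ENNReal.ofReal ((θ - x) ^ 2) ∂q ≤ ENNReal.ofReal (K * σ ^ 2)) :
    ENNReal.ofReal (1 / 2) ≤ q {θ | |θ - x| ≤ (K + 1) * σ} := by
  have hms : MeasurableSet {θ : ℝ | |θ - x| ≤ (K + 1) * σ} :=
    measurableSet_le (by fun_prop) measurable_const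
  have hc : q {θ | |θ - x| ≤ (K + 1) * σ}ᶜ ≤ ENNReal.ofReal (1 / 2) := by
    have hA : 0 < ((K + 1) * σ) ^ 2 := by positivity
    have hM := mul_meas_ge_le_lintegral (μ := q) (f := fun θ => ENNReal.ofReal ((θ - x) ^ 2))
      (by fun_prop) (ENNReal.ofReal (((K + 1) * σ) ^ 2))
    have hsub : {θ | |θ - x| ≤ (K + 1) * σ}ᶜ ⊆
        {θ | ENNReal.ofReal (((K + 1) * σ) ^ 2) ≤ ENNReal.ofReal ((θ - x) ^ 2)} := by
      intro θ hθ
      simp only [Set.mem_compl_iff, Set.mem_ofPred_eq, not_le] at hθ ⊢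
      refine ENNReal.ofReal_le_ofReal ?_
      rw [← sq_abs (θ - x)]
      exact pow_le_pow_left₀ (by positivity) hθ.le 2
    have h3 := (mul_le_mul_right (measure_mono hsub) _).trans (hM.trans h2)
    have h4 : ENNReal.ofReal (((K + 1) * σ) ^ 2) * q {θ | |θ - x| ≤ (K + 1) * σ}ᶜ ≤
        ENNReal.ofReal (((K + 1) * σ) ^ 2) * ENNReal.ofReal (1 / 2) := by
      refine h3.trans ?_
      rw [← ENNReal.ofReal_mul hA.le]
      refine ENNReal.ofReal_le_ofReal ?_
      nlinarith [mul_nonneg (sq_nonneg K) (sq_nonneg σ), sq_nonneg σ]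
    exact (ENNReal.mul_le_mul_iff_right (ENNReal.ofReal_pos.2 hA).ne' (by simp)).1 h4
  have hadd := measure_add_measure_compl (μ := q) hms
  rw [measure_univ] at hadd
  by_contra hn
  push Not at hn
  have : q {θ | |θ - x| ≤ (K + 1) * σ} + q {θ | |θ - x| ≤ (K + 1) * σ}ᶜ <
      ENNReal.ofReal (1 / 2) + ENNReal.ofReal (1 / 2) :=
    ENNReal.add_lt_add_of_lt_of_le (by finiteness) hn hc
  rw [hadd, ← ENNReal.ofReal_add (by norm_num) (by norm_num)] at this
  norm_num at this

theorem ofReal_mul_le_lintegral {q : Measure ℝ} {π : ℝ → ℝ} {S : Set ℝ}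
    (hS : MeasurableSet S) {v c : ℝ} (hv : 0 ≤ v) (hc : ENNReal.ofReal c ≤ q S)
    (h : ∀ θ ∈ S, v ≤ π θ) :
    ENNReal.ofReal (v * c) ≤ ∫⁻ θ, ENNReal.ofReal (π θ) ∂q := by
  rw [ENNReal.ofReal_mul hv]
  calc ENNReal.ofReal v * ENNReal.ofReal c ≤ ENNReal.ofReal v * q S := by gcongr
    _ = ∫⁻ _ in S, ENNReal.ofReal v ∂q := by simp
    _ ≤ ∫⁻ θ in S, ENNReal.ofReal (π θ) ∂q :=
        setLIntegral_mono' hS fun θ hθ => ENNReal.ofReal_le_ofReal (h θ hθ)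
    _ ≤ _ := setLIntegral_le_lintegral _ _

/-- A quasiunimodal prior is bounded below on an interval by its values at the endpoints. -/
theorem mul_min_le_of_abs_le {π : ℝ → ℝ} {m ε T θ : ℝ} (hε : 0 < ε)
    (hl : ∀ x₁ x₂, x₂ ≤ x₁ → x₁ ≤ m → ε * π x₂ ≤ π x₁)
    (hr : ∀ x₁ x₂, m ≤ x₁ → x₁ ≤ x₂ → ε * π x₂ ≤ π x₁) (hθ : |θ| ≤ T) :
    ε * min (π T) (π (-T)) ≤ π θ := by
  obtain ⟨h1, h2⟩ := abs_le.1 hθ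
  rcases le_total θ m with h | h
  · exact (mul_le_mul_of_nonneg_left (min_le_right _ _) hε.le).trans (hl _ _ h1 h)
  · exact (mul_le_mul_of_nonneg_left (min_le_left _ _) hε.le).trans (hr _ _ h h2)

/-- Both tails of a tail-dominating prior are positive; quasiunimodality fills the middle. -/
theorem pos_of_quasiunimodal_of_tailDominating {π : ℝ → ℝ} {L : ℝ → ℝ → ℝ → ℝ}
    (hπ0 : ∀ θ, 0 ≤ π θ) {m ε : ℝ} (hε : 0 < ε)
    (hl : ∀ x₁ x₂, x₂ ≤ x₁ → x₁ ≤ m → ε * π x₂ ≤ π x₁)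
    (hr : ∀ x₁ x₂, m ≤ x₁ → x₁ ≤ x₂ → ε * π x₂ ≤ π x₁) (hT : TailDominating π L) (θ : ℝ) :
    0 < π θ := by
  obtain ⟨r, s, hr0, h⟩ := hT
  have key : ∀ a, 1 ≤ a → 0 < π (r * a) ∧ 0 < π (-(r * a)) := by
    intro a ha
    obtain ⟨h1, h2⟩ := h 1 one_pos a ha 0
    have h1' := ENNReal.ofReal_pos.1 (bot_le.trans_lt h1)
    have h2' := ENNReal.ofReal_pos.1 (bot_le.trans_lt h2)
    rw [div_one] at h1' h2'
    constructor
    · refine lt_of_le_of_ne (hπ0 _) fun h => ?_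
      rw [← h] at h1'; simp at h1'
    · refine lt_of_le_of_ne (hπ0 _) fun h => ?_
      rw [← h] at h2'; simp at h2'
  obtain ⟨p1, p2⟩ := key (1 + |θ| / r) (by
    have : 0 ≤ |θ| / r := by positivity
    linarith)
  have e : |θ| ≤ r * (1 + |θ| / r) := by
    have : r * (1 + |θ| / r) = r + |θ| := by field_simp
    linarith
  exact lt_of_lt_of_le (mul_pos hε (lt_min p1 p2)) (mul_min_le_of_abs_le hε hl hr e)

/-- The second moment of the posterior about the observation. Far from `x` the likelihood is so
small, by tail domination, that reweighting by the prior cannot inflate it: relative to the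
smallest prior weight near `x`, the prior weight at distance `a` is bounded as soon as `a / σ` is of
the order of `|x| + σ + 1`. -/
theorem reweight_second_moment {q : Measure ℝ} [IsProbabilityMeasure q] {π : ℝ → ℝ}
    (hπ : Measurable π) (hπ0 : ∀ θ, 0 < π θ) {m ε : ℝ} (hε : 0 < ε)
    (hl : ∀ x₁ x₂, x₂ ≤ x₁ → x₁ ≤ m → ε * π x₂ ≤ π x₁)
    (hr : ∀ x₁ x₂, m ≤ x₁ → x₁ ≤ x₂ → ε * π x₂ ≤ π x₁) {K σ x r s T : ℝ} (hK : 0 ≤ K)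
    (hσ : 0 < σ) (h2 : ∫⁻ θ, ENNReal.ofReal ((θ - x) ^ 2) ∂q ≤ ENNReal.ofReal (K * σ ^ 2))
    (hr0 : 0 < r) (hs : 0 ≤ s)
    (htail : ∀ a, σ ≤ a →
      ∫⁻ θ, ENNReal.ofReal ((θ - x) ^ 2 - a ^ 2) ∂q ≤
        ENNReal.ofReal (s * σ * a * min (π (r * a / σ)) (π (-(r * a / σ)))))
    (hT : T = |x| + (K + 1) * σ + |m|) [IsProbabilityMeasure (reweight q π)] :
    ∫⁻ θ, ENNReal.ofReal ((θ - x) ^ 2) ∂reweight q π ≤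
      ENNReal.ofReal ((σ * (1 + T / r)) ^ 2 * (1 + 2 * π m * s / ε ^ 3)) := by
  have hT0 : 0 ≤ T := by rw [hT]; positivity
  set a := σ * (1 + T / r) with ha
  have haσ : σ ≤ a := by
    rw [ha]
    have : 0 ≤ σ * (T / r) := by positivity
    linarith
  have ha0 : 0 < a := hσ.trans_le haσ
  have hra : r * a / σ = r + T := by
    rw [ha]; field_simp
  have hbound : ∀ θ, π θ ≤ π m / ε := by
    intro θ
    rw [le_div_iff₀ hε, mul_comm]
    rcases le_total θ m with h | h
    · exact hl _ _ h le_rfl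
    · exact hr _ _ le_rfl h
  have hmT := abs_le.1 (show |m| ≤ T by rw [hT]; nlinarith [abs_nonneg x])
  set Pm := min (π T) (π (-T)) with hPm
  have hPm0 : 0 < Pm := lt_min (hπ0 _) (hπ0 _)
  have hPP : min (π (r + T)) (π (-(r + T))) ≤ Pm / ε := by
    rw [le_div_iff₀ hε, mul_comm]
    refine le_min ?_ ?_
    · exact (mul_le_mul_of_nonneg_left (min_le_left _ _) hε.le).trans
        (hr _ _ hmT.2 (by linarith))
    · exact (mul_le_mul_of_nonneg_left (min_le_right _ _) hε.le).trans
        (hl _ _ (by linarith) (by linarith))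
  have hZ : ENNReal.ofReal (ε * Pm * (1 / 2)) ≤ ∫⁻ θ, ENNReal.ofReal (π θ) ∂q := by
    refine ofReal_mul_le_lintegral (measurableSet_le (by fun_prop) measurable_const)
      (by positivity) (half_le_measure_near hK hσ h2) fun θ hθ => ?_
    refine mul_min_le_of_abs_le hε hl hr ?_
    have h1 : |θ| ≤ |θ - x| + |x| := by
      simpa using abs_add_le (θ - x) x
    simp only [Set.mem_ofPred_eq] at hθ
    rw [hT]
    linarith [abs_nonneg m]
  have hfar : ∫⁻ θ, ENNReal.ofReal ((θ - x) ^ 2 - a ^ 2) ∂reweight q π ≤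
      ENNReal.ofReal (2 * π m * s / ε ^ 3 * a ^ 2) := by
    have hm0 := hπ0 m
    refine lintegral_reweight_le hπ (y := π m / ε * (s * σ * a * (Pm / ε)))
      (by positivity) hZ ?_ ?_
    · calc ∫⁻ θ, ENNReal.ofReal (π θ) * ENNReal.ofReal ((θ - x) ^ 2 - a ^ 2) ∂q
          ≤ ∫⁻ θ, ENNReal.ofReal (π m / ε) * ENNReal.ofReal ((θ - x) ^ 2 - a ^ 2) ∂q := by
            refine lintegral_mono fun θ => ?_
            gcongr
            exact hbound θ
        _ = ENNReal.ofReal (π m / ε) * ∫⁻ θ, ENNReal.ofReal ((θ - x) ^ 2 - a ^ 2) ∂q :=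
            lintegral_const_mul _ (by fun_prop)
        _ ≤ ENNReal.ofReal (π m / ε) * ENNReal.ofReal (s * σ * a * (Pm / ε)) := by
            gcongr
            refine (htail a haσ).trans (ENNReal.ofReal_le_ofReal ?_)
            rw [hra]
            gcongr
        _ = _ := (ENNReal.ofReal_mul (by positivity)).symm
    · have e1 : π m / ε * (s * σ * a * (Pm / ε)) = (π m * s * Pm / ε ^ 2) * (σ * a) := by
        field_simp
      have e2 : 2 * π m * s / ε ^ 3 * a ^ 2 * (ε * Pm * (1 / 2)) =
          (π m * s * Pm / ε ^ 2) * (a * a) := by field_simp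
      rw [e1, e2]
      gcongr
  have hpt : ∀ θ, ENNReal.ofReal ((θ - x) ^ 2) ≤
      ENNReal.ofReal (a ^ 2) + ENNReal.ofReal ((θ - x) ^ 2 - a ^ 2) := by
    intro θ
    refine le_trans (ENNReal.ofReal_le_ofReal (?_ : _ ≤ a ^ 2 + ((θ - x) ^ 2 - a ^ 2)))
      ENNReal.ofReal_add_le
    linarith
  calc ∫⁻ θ, ENNReal.ofReal ((θ - x) ^ 2) ∂reweight q π
      ≤ ∫⁻ θ, (ENNReal.ofReal (a ^ 2) + ENNReal.ofReal ((θ - x) ^ 2 - a ^ 2)) ∂reweight q π :=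
        lintegral_mono hpt
    _ = ENNReal.ofReal (a ^ 2) +
        ∫⁻ θ, ENNReal.ofReal ((θ - x) ^ 2 - a ^ 2) ∂reweight q π := by
        rw [lintegral_add_left measurable_const]; simp
    _ ≤ ENNReal.ofReal (a ^ 2) + ENNReal.ofReal (2 * π m * s / ε ^ 3 * a ^ 2) := by gcongr
    _ = _ := by
        have := hπ0 m
        rw [← ENNReal.ofReal_add (by positivity) (by positivity)]
        congr 1; ring

theorem lintegral_abs_sub_le {q : Measure ℝ} [IsProbabilityMeasure q] {A x : ℝ} (hA : 0 < A)
    {B : ℝ} (hB : 0 ≤ B)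
    (h2 : ∫⁻ θ, ENNReal.ofReal ((θ - x) ^ 2) ∂q ≤ ENNReal.ofReal (B * A ^ 2)) :
    ∫⁻ θ, ENNReal.ofReal |θ - x| ∂q ≤ ENNReal.ofReal ((1 + B) / 2 * A) := by
  calc ∫⁻ θ, ENNReal.ofReal |θ - x| ∂q
      ≤ ∫⁻ θ, (ENNReal.ofReal (A / 2) +
          ENNReal.ofReal (1 / (2 * A)) * ENNReal.ofReal ((θ - x) ^ 2)) ∂q := by
        refine lintegral_mono fun θ => ?_
        rw [← ENNReal.ofReal_mul (by positivity),
          ← ENNReal.ofReal_add (by positivity) (by positivity)]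
        refine ENNReal.ofReal_le_ofReal ?_
        rw [← sq_abs (θ - x)]
        have e : A / 2 + 1 / (2 * A) * |θ - x| ^ 2 - |θ - x| = (|θ - x| - A) ^ 2 / (2 * A) := by
          field_simp; ring
        have : 0 ≤ (|θ - x| - A) ^ 2 / (2 * A) := by positivity
        linarith
    _ = ENNReal.ofReal (A / 2) +
          ENNReal.ofReal (1 / (2 * A)) * ∫⁻ θ, ENNReal.ofReal ((θ - x) ^ 2) ∂q := by
        rw [lintegral_add_left measurable_const, lintegral_const_mul _ (by fun_prop)]; simp
    _ ≤ ENNReal.ofReal (A / 2) +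
          ENNReal.ofReal (1 / (2 * A)) * ENNReal.ofReal (B * A ^ 2) := by gcongr
    _ = _ := by
        rw [← ENNReal.ofReal_mul (by positivity),
          ← ENNReal.ofReal_add (by positivity) (by positivity)]
        congr 1; field_simp

/-- Suppose that a quarter of the mass of `q` lies in a set `N` on which the prior is not smaller,
up to a constant, than its value at some `u`, and that on `F` the prior is not larger, up to a
constant, than at `u`. Then reweighting does not inflate the mean distance from `x` on `F`. -/
theorem reweight_onesided {q : Measure ℝ} [IsProbabilityMeasure q] {π : ℝ → ℝ}
    (hπ : Measurable π) (hπ0 : ∀ θ, 0 < π θ) {ε : ℝ} (hε : 0 < ε) {K σ x : ℝ} (hK : 0 ≤ K)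
    (hσ : 0 < σ) (h2 : ∫⁻ θ, ENNReal.ofReal ((θ - x) ^ 2) ∂q ≤ ENNReal.ofReal (K * σ ^ 2))
    {N F : Set ℝ} (hmN : MeasurableSet N) {u : ℝ}
    (hN : ENNReal.ofReal (1 / 4) ≤ q N) (hNu : ∀ θ ∈ N, ε * π u ≤ π θ)
    (hFu : ∀ θ ∈ F, ε * π θ ≤ π u) {f : ℝ → ℝ} (hf : ∀ θ, f θ ≤ |θ - x|)
    (hfF : ∀ θ, θ ∉ F → f θ ≤ (K + 1) * σ) [IsProbabilityMeasure (reweight q π)] :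
    ∫⁻ θ, ENNReal.ofReal (f θ) ∂reweight q π ≤
      ENNReal.ofReal ((K + 1) * (1 + 4 / ε ^ 2) * σ) := by
  have hu0 := hπ0 u
  have hZ : ENNReal.ofReal (ε * π u * (1 / 4)) ≤ ∫⁻ θ, ENNReal.ofReal (π θ) ∂q :=
    ofReal_mul_le_lintegral hmN (by positivity) hN hNu
  have hfar : ∫⁻ θ, F.indicator (fun θ => ENNReal.ofReal |θ - x|) θ ∂reweight q π ≤
      ENNReal.ofReal ((K + 1) * (4 / ε ^ 2) * σ) := by
    refine lintegral_reweight_le hπ (y := π u / ε * ((1 + K) / 2 * σ))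
      (by positivity) hZ ?_ ?_
    · calc ∫⁻ θ, ENNReal.ofReal (π θ) * F.indicator (fun θ => ENNReal.ofReal |θ - x|) θ ∂q
          ≤ ∫⁻ θ, ENNReal.ofReal (π u / ε) * ENNReal.ofReal |θ - x| ∂q := by
            refine lintegral_mono fun θ => ?_
            by_cases h : θ ∈ F
            · rw [Set.indicator_of_mem h]
              gcongr
              rw [le_div_iff₀ hε, mul_comm]
              exact hFu θ h
            · rw [Set.indicator_of_notMem h]
              simp
        _ = ENNReal.ofReal (π u / ε) * ∫⁻ θ, ENNReal.ofReal |θ - x| ∂q :=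
            lintegral_const_mul _ (by fun_prop)
        _ ≤ ENNReal.ofReal (π u / ε) * ENNReal.ofReal ((1 + K) / 2 * σ) := by
            gcongr
            exact lintegral_abs_sub_le hσ hK h2
        _ = _ := (ENNReal.ofReal_mul (by positivity)).symm
    · have e1 : (K + 1) * (4 / ε ^ 2) * σ * (ε * π u * (1 / 4)) =
          π u / ε * ((1 + K) * σ) := by field_simp; ring
      rw [e1]
      have : 0 < π u / ε := by positivity
      gcongr
      linarith
  have hpt : ∀ θ, ENNReal.ofReal (f θ) ≤ ENNReal.ofReal ((K + 1) * σ) +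
      F.indicator (fun θ => ENNReal.ofReal |θ - x|) θ := by
    intro θ
    by_cases h : θ ∈ F
    · rw [Set.indicator_of_mem h]
      exact le_add_left (ENNReal.ofReal_le_ofReal (hf θ))
    · rw [Set.indicator_of_notMem h, add_zero]
      exact ENNReal.ofReal_le_ofReal (hfF θ h)
  calc ∫⁻ θ, ENNReal.ofReal (f θ) ∂reweight q π
      ≤ ∫⁻ θ, (ENNReal.ofReal ((K + 1) * σ) +
          F.indicator (fun θ => ENNReal.ofReal |θ - x|) θ) ∂reweight q π :=
        lintegral_mono hpt
    _ = ENNReal.ofReal ((K + 1) * σ) +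
        ∫⁻ θ, F.indicator (fun θ => ENNReal.ofReal |θ - x|) θ ∂reweight q π := by
        rw [lintegral_add_left measurable_const]; simp
    _ ≤ ENNReal.ofReal ((K + 1) * σ) + ENNReal.ofReal ((K + 1) * (4 / ε ^ 2) * σ) := by gcongr
    _ = _ := by
        rw [← ENNReal.ofReal_add (by positivity) (by positivity)]
        congr 1; ring

/-- On one side at least, the posterior deviates from the observation by `O(σ)` on average: a
quarter of the mass of `q` lies near `x` on one side of the quasimode, and further out on
that side the prior is not larger, up to a constant, than on this mass. -/
theorem reweight_overshoot_or_undershoot {q : Measure ℝ} [IsProbabilityMeasure q] {π : ℝ → ℝ}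
    (hπ : Measurable π) (hπ0 : ∀ θ, 0 < π θ) {m ε : ℝ} (hε : 0 < ε)
    (hl : ∀ x₁ x₂, x₂ ≤ x₁ → x₁ ≤ m → ε * π x₂ ≤ π x₁)
    (hr : ∀ x₁ x₂, m ≤ x₁ → x₁ ≤ x₂ → ε * π x₂ ≤ π x₁) {K σ x : ℝ} (hK : 0 ≤ K)
    (hσ : 0 < σ) (h2 : ∫⁻ θ, ENNReal.ofReal ((θ - x) ^ 2) ∂q ≤ ENNReal.ofReal (K * σ ^ 2))
    [IsProbabilityMeasure (reweight q π)] :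
    ∫⁻ θ, ENNReal.ofReal (θ - x) ∂reweight q π ≤
        ENNReal.ofReal ((K + 1) * (1 + 4 / ε ^ 2) * σ) ∨
    ∫⁻ θ, ENNReal.ofReal (x - θ) ∂reweight q π ≤
        ENNReal.ofReal ((K + 1) * (1 + 4 / ε ^ 2) * σ) := by
  have hms : MeasurableSet {θ : ℝ | |θ - x| ≤ (K + 1) * σ} :=
    measurableSet_le (by fun_prop) measurable_const
  have hN := half_le_measure_near hK hσ h2
  set N := {θ : ℝ | |θ - x| ≤ (K + 1) * σ}
  have hNI : ∀ θ ∈ N, x - (K + 1) * σ ≤ θ ∧ θ ≤ x + (K + 1) * σ := fun θ hθ => by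
    have := abs_le.1 (show |θ - x| ≤ (K + 1) * σ from hθ)
    constructor <;> linarith [this.1, this.2]
  have hsplit : ENNReal.ofReal (1 / 4) ≤ q (N ∩ Set.Ici m) ∨
      ENNReal.ofReal (1 / 4) ≤ q (N ∩ Set.Iic m) := by
    by_contra! hn
    have h1 : q N ≤ q (N ∩ Set.Ici m) + q (N ∩ Set.Iic m) := by
      refine (measure_mono fun θ hθ => ?_).trans (measure_union_le _ _)
      rcases le_total m θ with h | h
      · exact Or.inl ⟨hθ, h⟩
      · exact Or.inr ⟨hθ, h⟩
    have h3 := (hN.trans h1).trans_lt (ENNReal.add_lt_add hn.1 hn.2)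
    rw [← ENNReal.ofReal_add (by norm_num) (by norm_num)] at h3
    norm_num at h3
  have hne : ∀ S : Set ℝ, ENNReal.ofReal (1 / 4) ≤ q S → S.Nonempty := by
    intro S hS
    by_contra h
    rw [Set.not_nonempty_iff_eq_empty] at h
    rw [h] at hS
    norm_num at hS
  rcases hsplit with h | h
  · left
    obtain ⟨θ₀, h₀, h₀m⟩ := hne _ h
    have hmu : m ≤ x + (K + 1) * σ := le_trans h₀m (hNI θ₀ h₀).2
    refine reweight_onesided hπ hπ0 hε hK hσ h2 (hms.inter measurableSet_Ici) h
      (u := x + (K + 1) * σ) (F := Set.Ioi (x + (K + 1) * σ))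
      (fun θ hθ => hr _ _ hθ.2 (hNI θ hθ.1).2)
      (fun θ hθ => hr _ _ hmu (le_of_lt hθ)) (fun θ => le_abs_self _) fun θ hθ => ?_
    rw [Set.mem_Ioi, not_lt] at hθ
    linarith
  · right
    obtain ⟨θ₀, h₀, h₀m⟩ := hne _ h
    have hmu : x - (K + 1) * σ ≤ m := le_trans (hNI θ₀ h₀).1 h₀m
    refine reweight_onesided hπ hπ0 hε hK hσ h2 (hms.inter measurableSet_Iic) h
      (u := x - (K + 1) * σ) (F := Set.Iio (x - (K + 1) * σ))
      (fun θ hθ => hl _ _ (hNI θ hθ.1).1 hθ.2)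
      (fun θ hθ => hl _ _ (le_of_lt hθ) hmu)
      (fun θ => (le_abs_self _).trans (abs_sub_comm _ _).le) fun θ hθ => ?_
    rw [Set.mem_Iio, not_lt] at hθ
    linarith

/-- A family of probability measures `q x σ` is concentrated if `q x σ` has second moment about `x`
at most `(C σ (1 + |x| + σ)) ^ 2`, and either its mean upward or its mean downward deviation
from `x` is at most `C σ`. -/
structure Concentrated (C : ℝ) (q : ℝ → ℝ → Measure ℝ) : Prop where
  isProbabilityMeasure : ∀ x σ, 0 < σ → IsProbabilityMeasure (q x σ)
  second_moment : ∀ x σ, 0 < σ →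
    ∫⁻ θ, ENNReal.ofReal ((θ - x) ^ 2) ∂q x σ ≤ ENNReal.ofReal ((C * σ * (1 + |x| + σ)) ^ 2)
  onesided : ∀ x σ, 0 < σ →
    ∫⁻ θ, ENNReal.ofReal (θ - x) ∂q x σ ≤ ENNReal.ofReal (C * σ) ∨
    ∫⁻ θ, ENNReal.ofReal (x - θ) ∂q x σ ≤ ENNReal.ofReal (C * σ)

theorem exists_concentrated_posterior {π : ℝ → ℝ} {L : ℝ → ℝ → ℝ → ℝ}
    (hm : Measurable fun z : ℝ × ℝ × ℝ => L z.1 z.2.1 z.2.2) (h0 : ∀ x θ σ, 0 ≤ L x θ σ)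
    (hL : RegularLikelihood L) (hπ : Measurable π) (hπ0 : ∀ θ, 0 ≤ π θ)
    (hquasi : Quasiunimodal π) (htail : TailDominating π L) :
    ∃ C, 1 ≤ C ∧ Concentrated C (posterior π L) := by
  obtain ⟨m, ε, hε, hl, hr⟩ := hquasi
  have hpos := pos_of_quasiunimodal_of_tailDominating hπ0 hε hl hr htail
  obtain ⟨r, s, hr0, htail⟩ := htail
  obtain ⟨K, hK, hq⟩ := likelihoodLaw_moment hm h0 hL
  have hs : 0 ≤ s := by
    have h1 := ENNReal.ofReal_pos.1 (bot_le.trans_lt (htail 1 one_pos 1 le_rfl 0).1)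
    have h2 := hpos (r * 1 / 1)
    by_contra hn
    push Not at hn
    nlinarith
  have hmp := hpos m
  set C₁ := (K + 1) * (1 + 4 / ε ^ 2) with hC₁
  set C₂ := 1 + 2 * π m * s / ε ^ 3 with hC₂
  set C₃ := 1 + (K + 2 + |m|) / r with hC₃
  have hC₁p : 0 ≤ C₁ := by positivity
  have hC₂p : 1 ≤ C₂ := by
    have : 0 ≤ 2 * π m * s / ε ^ 3 := by positivity
    linarith
  have hC₃p : 1 ≤ C₃ := by
    have : 0 ≤ (K + 2 + |m|) / r := by positivity
    linarith
  have hC : 1 ≤ C₁ + C₂ * C₃ := by nlinarith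
  have hprob : ∀ x σ, 0 < σ → IsProbabilityMeasure (reweight (likelihoodLaw L x σ) π) := by
    intro x σ hσ
    obtain ⟨-, -, hP, h2⟩ := hq σ hσ x
    have hZ0 : (∫⁻ θ, ENNReal.ofReal (π θ) ∂likelihoodLaw L x σ) ≠ 0 := by
      rw [Ne, lintegral_eq_zero_iff hπ.ennreal_ofReal]
      intro h
      have : ∀ᵐ θ ∂likelihoodLaw L x σ, False := by
        filter_upwards [h] with θ hθ
        have := hpos θ
        simp only [Pi.zero_apply, ENNReal.ofReal_eq_zero] at hθ
        linarith
      simp at this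
      exact IsProbabilityMeasure.ne_zero _ this
    have hZ : (∫⁻ θ, ENNReal.ofReal (π θ) ∂likelihoodLaw L x σ) ≠ ∞ := by
      refine ne_top_of_le_ne_top (b := ENNReal.ofReal (π m / ε)) (by simp) ?_
      calc ∫⁻ θ, ENNReal.ofReal (π θ) ∂likelihoodLaw L x σ
          ≤ ∫⁻ _, ENNReal.ofReal (π m / ε) ∂likelihoodLaw L x σ := by
            refine lintegral_mono fun θ => ENNReal.ofReal_le_ofReal ?_
            rw [le_div_iff₀ hε, mul_comm]
            rcases le_total θ m with h | h
            · exact hl _ _ h le_rfl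
            · exact hr _ _ le_rfl h
        _ = _ := by simp
    refine ⟨?_⟩
    rw [reweight]
    simp [ENNReal.inv_mul_cancel hZ0 hZ]
  have heq : ∀ x σ, 0 < σ → posterior π L x σ = reweight (likelihoodLaw L x σ) π :=
    fun x σ hσ => posterior_eq_reweight hπ hπ0
      (hm.comp (by fun_prop : Measurable fun θ : ℝ => ((x, θ, σ) : ℝ × ℝ × ℝ)))
      (hq σ hσ x).1 (hq σ hσ x).2.1
  refine ⟨C₁ + C₂ * C₃, hC, ⟨fun x σ hσ => ?_, fun x σ hσ => ?_, fun x σ hσ => ?_⟩⟩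
  · rw [heq x σ hσ]; exact hprob x σ hσ
  · have := hprob x σ hσ
    obtain ⟨-, -, hP, h2⟩ := hq σ hσ x
    rw [heq x σ hσ]
    refine (reweight_second_moment hπ hpos hε hl hr hK hσ h2 hr0 hs (fun a ha => ?_) rfl).trans
      (ENNReal.ofReal_le_ofReal ?_)
    · obtain ⟨t1, t2⟩ := htail σ hσ a ha x
      have hsa : 0 ≤ s * σ * a := by have := hσ.trans_le ha; positivity
      rw [mul_min_of_nonneg _ _ hsa, ENNReal.ofReal_min]
      exact le_min t1.le t2.le
    · have hQ : 1 + (|x| + (K + 1) * σ + |m|) / r ≤ C₃ * (1 + |x| + σ) := by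
        have e : C₃ * (1 + |x| + σ) - (1 + (|x| + (K + 1) * σ + |m|) / r) =
            |x| + σ + ((K + 2) + |x| * (K + 1 + |m|) + σ * (1 + |m|)) / r := by
          rw [hC₃]; field_simp; ring
        have : 0 ≤ |x| + σ + ((K + 2) + |x| * (K + 1 + |m|) + σ * (1 + |m|)) / r := by
          positivity
        linarith
      have h1 : (σ * (1 + (|x| + (K + 1) * σ + |m|) / r)) ^ 2 ≤
          (σ * (C₃ * (1 + |x| + σ))) ^ 2 := by
        gcongr
      calc (σ * (1 + (|x| + (K + 1) * σ + |m|) / r)) ^ 2 * C₂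
          ≤ (σ * (C₃ * (1 + |x| + σ))) ^ 2 * C₂ ^ 2 := by
            gcongr
            exact le_self_pow₀ hC₂p (by norm_num)
        _ = ((C₂ * C₃) * σ * (1 + |x| + σ)) ^ 2 := by ring
        _ ≤ _ := by
            gcongr
            linarith
  · have := hprob x σ hσ
    obtain ⟨-, -, hP, h2⟩ := hq σ hσ x
    rw [heq x σ hσ]
    have hle : ENNReal.ofReal (C₁ * σ) ≤ ENNReal.ofReal ((C₁ + C₂ * C₃) * σ) := by
      refine ENNReal.ofReal_le_ofReal ?_
      gcongr
      nlinarith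
    exact (reweight_overshoot_or_undershoot hπ hpos hε hl hr hK hσ h2).imp
      (fun h => h.trans hle) fun h => h.trans hle

/-! ### Pairwise losses -/

theorem Restrained.exists_lower_bound {l : ℝ → ℝ → ℝ} (hl : IsPairwiseLoss l)
    (hr : Restrained l) :
    ∃ a b : ℝ, 0 < a ∧ 0 < b ∧ ∀ x y, b * max (min (y - x) a) 0 ≤ l x y := by
  obtain ⟨hmono, -, lam, -, ⟨a, b, ha, hb, h⟩, -⟩ := hr
  refine ⟨a / 2, b, by positivity, hb, fun x y => ?_⟩
  rcases le_or_gt y x with hxy | hxy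
  · rw [hl.1 x y hxy, max_eq_right (by
      exact (min_le_left _ _).trans (by linarith)), mul_zero]
  · rw [max_eq_left (le_min (by linarith) (by linarith))]
    rcases le_total (y - x) (a / 2) with h1 | h1
    · rw [min_eq_left h1]
      exact (h x y hxy (by linarith)).le
    · rw [min_eq_right h1]
      have h2 := (h x (x + a / 2) (by linarith) (by linarith)).le
      have h3 : l x (x + a / 2) ≤ l x y := hmono x (by linarith)
      rw [add_sub_cancel_left] at h2
      linarith

theorem Restrained.exists_upper_bound {l : ℝ → ℝ → ℝ} (hr : Restrained l) :
    ∃ c : ℝ, 0 < c ∧ ∀ x y, x < y → l x y ≤ c * (1 + (y - x)) := by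
  obtain ⟨-, -, lam, -, -, ⟨D, h⟩⟩ := hr
  refine ⟨|D| + lam + 1, by positivity, fun x y hxy => ?_⟩
  have h1 := h x (y - x) (by linarith)
  rw [add_sub_cancel] at h1
  have h2 := le_abs_self D
  have h3 : 0 ≤ |D| * (y - x) := mul_nonneg (abs_nonneg _) (by linarith)
  have h4 : (0 : ℝ) ≤ lam := lam.2
  nlinarith

theorem IsPairwiseLoss.nonneg {l : ℝ → ℝ → ℝ} (hl : IsPairwiseLoss l) (x y : ℝ) :
    0 ≤ l x y := by
  rcases le_or_gt y x with h | h
  · exact (hl.1 x y h).ge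
  · exact (hl.2 x y h).le

/-- Splitting the loss of misranking a gap `t` at the scale `η`: gaps below `η` are rare, gaps of
moderate size are controlled by `min t a`, and large ones by the second moment of the gap. -/
theorem one_add_le_of_scale {a η t : ℝ} (ha : 0 < a) (hη : 0 < η) (hη1 : η ≤ 1) (ht : 0 < t) :
    1 + t ≤ (2 + a + 2 / a) * ((if t < η then 1 else 0) + η * t ^ 2 + 1 / η * min t a) := by
  have h2a : 0 < 2 / a := by positivity
  have hmin : 0 < min t a := lt_min ht ha
  have hX : 0 ≤ η * t ^ 2 := by positivity
  have hY : 0 ≤ 1 / η * min t a := by positivity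
  split_ifs with h
  · nlinarith
  · push Not at h
    rw [zero_add]
    rcases le_total t a with hta | hta
    · rw [min_eq_left hta] at hY ⊢
      have : 1 ≤ 1 / η * t := by
        rw [one_div, inv_mul_eq_div, one_le_div hη]; exact h
      nlinarith
    · rw [min_eq_right hta] at hY ⊢
      have h1 : 1 ≤ 1 / η := by rw [one_le_div hη]; exact hη1
      have h3 : t ≤ η * t ^ 2 + 1 / η := by
        have e : η * t ^ 2 + 1 / η - t = (η * t - 1) ^ 2 / η + t := by field_simp; ring
        have : 0 ≤ (η * t - 1) ^ 2 / η + t := by positivity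
        linarith
      have e : (2 + a + 2 / a) * (1 / η * a) = (2 + a) * (1 / η * a) + 2 * (1 / η) := by
        field_simp
      have e' : 0 ≤ (2 + a) * (1 / η * a) := by positivity
      nlinarith

/-! ### Sums over ranked pairs -/

theorem sum_ranked_pairs_le {p : ℕ} (e : Equiv.Perm (Fin p)) (f : Fin p → Fin p → ℝ≥0∞) :
    ∑ k, ∑ l ∈ Finset.Ioi k, f (e k) (e l) ≤ ∑ i, ∑ j with j ≠ i, f i j := by
  calc ∑ k, ∑ l ∈ Finset.Ioi k, f (e k) (e l)
      ≤ ∑ k, ∑ l with l ≠ k, f (e k) (e l) := by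
        refine Finset.sum_le_sum fun k _ => Finset.sum_le_sum_of_subset fun l hl => ?_
        simpa using (Finset.mem_Ioi.1 hl).ne'
    _ = ∑ k, ∑ l, if e l ≠ e k then f (e k) (e l) else 0 := by
        simp [Finset.sum_filter]
    _ = ∑ k, ∑ j, if j ≠ e k then f (e k) j else 0 :=
        Finset.sum_congr rfl fun k _ => Equiv.sum_comp e fun j => if j ≠ e k then f (e k) j else 0
    _ = ∑ i, ∑ j, if j ≠ i then f i j else 0 :=
        Equiv.sum_comp e fun i => ∑ j, if j ≠ i then f i j else 0
    _ = _ := by simp [Finset.sum_filter]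

theorem ofReal_le_of_le_additiveLoss {s : ℕ → ℝ} {l : ℝ → ℝ → ℝ} {M : (p : ℕ) → (Fin p → ℝ) → ℝ}
    (hl : IsPairwiseLoss l) {c : ℝ} (hc : 0 < c) {p : ℕ} (hs : 0 < s p) {y : Fin p → ℝ}
    (h : c * M p y ≤ additiveLoss s l p y) :
    ENNReal.ofReal (M p y) ≤ ENNReal.ofReal (s p / c) *
      ∑ k, ∑ j ∈ Finset.Ioi k, ENNReal.ofReal (l (y k) (y j)) := by
  have e : ∑ k, ∑ j ∈ Finset.Ioi k, ENNReal.ofReal (l (y k) (y j)) =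
      ENNReal.ofReal (∑ k, ∑ j ∈ Finset.Ioi k, l (y k) (y j)) := by
    rw [ENNReal.ofReal_sum_of_nonneg fun k _ => Finset.sum_nonneg fun j _ => hl.nonneg _ _]
    refine Finset.sum_congr rfl fun k _ => ?_
    rw [ENNReal.ofReal_sum_of_nonneg fun j _ => hl.nonneg _ _]
  rw [e, ← ENNReal.ofReal_mul (by positivity)]
  refine ENNReal.ofReal_le_ofReal ?_
  rw [div_mul_eq_mul_div, le_div_iff₀ hc, mul_comm]
  exact h

theorem le_ofReal_of_additiveLoss_le {s : ℕ → ℝ} {l : ℝ → ℝ → ℝ} {M : (p : ℕ) → (Fin p → ℝ) → ℝ}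
    {u a b : ℝ} (hu : 0 < u) (hb : 0 < b)
    (hl : ∀ x y, b * max (min (y - x) a) 0 ≤ l x y) {p : ℕ} (hs : 0 < s p) {y : Fin p → ℝ}
    (h : additiveLoss s l p y ≤ u * M p y) :
    ENNReal.ofReal (s p * b / u) *
      ∑ k, ∑ j ∈ Finset.Ioi k, ENNReal.ofReal (min (y j - y k) a) ≤ ENNReal.ofReal (M p y) := by
  have e : ∑ k, ∑ j ∈ Finset.Ioi k, ENNReal.ofReal (min (y j - y k) a) =
      ENNReal.ofReal (∑ k, ∑ j ∈ Finset.Ioi k, max (min (y j - y k) a) 0) := by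
    rw [ENNReal.ofReal_sum_of_nonneg fun k _ => Finset.sum_nonneg fun j _ => le_max_right _ _]
    refine Finset.sum_congr rfl fun k _ => ?_
    rw [ENNReal.ofReal_sum_of_nonneg fun j _ => le_max_right _ _]
    refine Finset.sum_congr rfl fun j _ => ?_
    rw [ENNReal.ofReal_max, ENNReal.ofReal_zero, max_eq_left zero_le]
  rw [e, ← ENNReal.ofReal_mul (by positivity)]
  refine ENNReal.ofReal_le_ofReal ?_
  rw [div_mul_eq_mul_div, div_le_iff₀ hu, mul_comm _ u]
  refine le_trans ?_ h
  rw [additiveLoss, mul_assoc, Finset.mul_sum]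
  refine mul_le_mul_of_nonneg_left (Finset.sum_le_sum fun k _ => ?_) hs.le
  rw [Finset.mul_sum]
  exact Finset.sum_le_sum fun j _ => hl _ _

/-! ### Posterior loss of a pair of units -/

/-- The bound for the root mean square deviation of the posterior from the observation. -/
def spread (C x σ : ℝ) : ℝ := C * σ * (1 + |x| + σ)

/-- A bound for the posterior loss of a pair of units that are compared by their scores. If both
standard deviations are at most `1`, the units are ranked by their observations, and the bound
is the Chebyshev estimate of the probability of a misranking plus the spreads of both units. -/
noncomputable def pairBound (C x σ x' σ' : ℝ) : ℝ :=
  if σ ≤ 1 ∧ σ' ≤ 1 then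
    2 * (4 * (spread C x σ ^ 2 + spread C x' σ' ^ 2)) /
      (4 * (spread C x σ ^ 2 + spread C x' σ' ^ 2) + (x - x') ^ 2) +
    (spread C x σ + spread C x' σ')
  else (4 * C + 7) * ((1 + σ + |x|) * (1 + σ' + |x'|))

theorem spread_pos {C x σ : ℝ} (hC : 1 ≤ C) (hσ : 0 < σ) : 0 < spread C x σ := by
  unfold spread; positivity

theorem Concentrated.lintegral_abs_le {C : ℝ} {q : ℝ → ℝ → Measure ℝ} (hq : Concentrated C q)
    (hC : 1 ≤ C) {x σ : ℝ} (hσ : 0 < σ) :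
    ∫⁻ θ, ENNReal.ofReal |θ - x| ∂q x σ ≤ ENNReal.ofReal (spread C x σ) := by
  have := hq.isProbabilityMeasure x σ hσ
  have h := lintegral_abs_sub_le (q := q x σ) (x := x) (spread_pos (x := x) hC hσ) zero_le_one
    (by rw [one_mul]; exact hq.second_moment x σ hσ)
  norm_num at h
  exact h

/-- The score of a unit. A unit with small standard deviation is scored by its observation. If the
standard deviation is large, the posterior may be spread out far on one side of the
observation; the score is then moved to the far end of that side, so that the long deviations cost
little in comparisons with other units. -/
theorem Concentrated.exists_score {C : ℝ} {q : ℝ → ℝ → Measure ℝ} (hq : Concentrated C q)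
    (hC : 1 ≤ C) {x σ : ℝ} (hσ : 0 < σ) :
    ∃ y, |y - x| ≤ C * (1 + σ + |x|) ^ 2 ∧ (σ ≤ 1 → y = x) ∧
      ∫⁻ θ, ENNReal.ofReal (x - θ) ∂q x σ ≤
        ENNReal.ofReal (C * (1 + σ + |x|) + max (x - y) 0) ∧
      ∫⁻ θ, ENNReal.ofReal (θ - x) ∂q x σ ≤
        ENNReal.ofReal (C * (1 + σ + |x|) + max (y - x) 0) := by
  have hA := spread_pos (x := x) hC hσ
  have hup : ∫⁻ θ, ENNReal.ofReal (θ - x) ∂q x σ ≤ ENNReal.ofReal (spread C x σ) :=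
    (lintegral_mono fun θ => ENNReal.ofReal_le_ofReal (le_abs_self _)).trans
      (hq.lintegral_abs_le hC hσ)
  have hdown : ∫⁻ θ, ENNReal.ofReal (x - θ) ∂q x σ ≤ ENNReal.ofReal (spread C x σ) :=
    (lintegral_mono fun θ => ENNReal.ofReal_le_ofReal
      ((le_abs_self _).trans (abs_sub_comm _ _).le)).trans (hq.lintegral_abs_le hC hσ)
  have hx := abs_nonneg x
  have hAQ : spread C x σ ≤ C * (1 + σ + |x|) ^ 2 := by
    have e : C * (1 + σ + |x|) ^ 2 - spread C x σ = C * ((1 + |x|) * (1 + σ + |x|)) := by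
      unfold spread; ring
    have : 0 ≤ C * ((1 + |x|) * (1 + σ + |x|)) := by positivity
    linarith
  have hCQ : 0 ≤ C * (1 + |x|) := by positivity
  rcases le_or_gt σ 1 with h1 | h1
  · have hle : spread C x σ ≤ C * (1 + σ + |x|) + max (x - x) 0 := by
      have e : C * (1 + σ + |x|) - spread C x σ = C * (1 + σ + |x|) * (1 - σ) := by
        unfold spread; ring
      have : 0 ≤ C * (1 + σ + |x|) * (1 - σ) := mul_nonneg (by positivity) (by linarith)
      rw [sub_self, max_self]
      linarith
    refine ⟨x, ?_, fun _ => rfl, ?_, ?_⟩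
    · rw [sub_self, abs_zero]; positivity
    · exact hdown.trans (ENNReal.ofReal_le_ofReal hle)
    · exact hup.trans (ENNReal.ofReal_le_ofReal hle)
  · have hle : ∀ t : ℝ, C * σ ≤ C * (1 + σ + |x|) + max t 0 := fun t => by
      have := le_max_right t 0
      nlinarith
    have hle' : ∀ t : ℝ, t = spread C x σ → spread C x σ ≤ C * (1 + σ + |x|) + max t 0 :=
      fun t ht => by
        have := le_max_left t 0
        have : 0 ≤ C * (1 + σ + |x|) := by positivity
        linarith
    rcases hq.onesided x σ hσ with h | h
    · refine ⟨x - spread C x σ, ?_, fun h => absurd h (not_le.2 h1), ?_, ?_⟩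
      · rw [sub_sub_cancel_left, abs_neg, abs_of_pos hA]; exact hAQ
      · exact hdown.trans (ENNReal.ofReal_le_ofReal (hle' _ (by ring)))
      · exact h.trans (ENNReal.ofReal_le_ofReal (hle _))
    · refine ⟨x + spread C x σ, ?_, fun h => absurd h (not_le.2 h1), ?_, ?_⟩
      · rw [add_sub_cancel_left, abs_of_pos hA]; exact hAQ
      · exact h.trans (ENNReal.ofReal_le_ofReal (hle _))
      · exact hup.trans (ENNReal.ofReal_le_ofReal (hle' _ (by ring)))

/-- The excess of a score over its observation costs at most the product of the sizes of the two
units, as it is bounded by the square of either size. -/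
theorem score_excess_le {C d Q Q' : ℝ} (hC : 0 ≤ C) (hQ : 1 ≤ Q) (hQ' : 1 ≤ Q')
    (h1 : d ≤ C * Q ^ 2) (h2 : d ≤ Q + Q' + C * Q' ^ 2) : max d 0 ≤ (C + 2) * (Q * Q') := by
  have hQQ : 0 ≤ C * (Q * Q') := by positivity
  refine max_le ?_ (by nlinarith)
  rcases le_total Q Q' with h | h
  · have : C * Q ^ 2 ≤ C * (Q * Q') := by
      rw [sq]; gcongr
    nlinarith
  · have : C * Q' ^ 2 ≤ C * (Q * Q') := by
      rw [sq]; gcongr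
    nlinarith

theorem lintegral_add_mul_ofReal {q : Measure ℝ} [IsProbabilityMeasure q] {f : ℝ → ℝ}
    (hf : Measurable f) {c k v : ℝ} (hc : 0 ≤ c) (hk : 0 ≤ k) (hv : 0 ≤ v)
    (h : ∫⁻ θ, ENNReal.ofReal (f θ) ∂q ≤ ENNReal.ofReal v) :
    ∫⁻ θ, (ENNReal.ofReal c + ENNReal.ofReal k * ENNReal.ofReal (f θ)) ∂q ≤
      ENNReal.ofReal (c + k * v) := by
  rw [lintegral_add_left measurable_const, lintegral_const_mul _ hf.ennreal_ofReal,
    lintegral_const, measure_univ, mul_one, ENNReal.ofReal_add hc (by positivity),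
    ENNReal.ofReal_mul hk]
  gcongr

/-- The posterior loss of a pair that is ranked according to its scores, bounded by functions of
the single units. -/
theorem Concentrated.pair_loss_le {C : ℝ} {q : ℝ → ℝ → Measure ℝ} (hq : Concentrated C q)
    (hC : 1 ≤ C) {x σ y x' σ' y' : ℝ} (hσ : 0 < σ) (hσ' : 0 < σ')
    (hy : |y - x| ≤ C * (1 + σ + |x|) ^ 2) (hyx : σ ≤ 1 → y = x)
    (hd : ∫⁻ θ, ENNReal.ofReal (x - θ) ∂q x σ ≤
        ENNReal.ofReal (C * (1 + σ + |x|) + max (x - y) 0))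
    (hy' : |y' - x'| ≤ C * (1 + σ' + |x'|) ^ 2) (hyx' : σ' ≤ 1 → y' = x')
    (hu' : ∫⁻ θ, ENNReal.ofReal (θ - x') ∂q x' σ' ≤
        ENNReal.ofReal (C * (1 + σ' + |x'|) + max (y' - x') 0)) (hyy : y' ≤ y) :
    ∃ φ ψ : ℝ → ℝ≥0∞, Measurable φ ∧ Measurable ψ ∧
      (∀ θ θ', θ < θ' → ENNReal.ofReal (1 + (θ' - θ)) ≤ φ θ + ψ θ') ∧
      ∫⁻ θ, φ θ ∂q x σ + ∫⁻ θ, ψ θ ∂q x' σ' ≤ ENNReal.ofReal (pairBound C x σ x' σ') := by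
  have hP := hq.isProbabilityMeasure x σ hσ
  have hP' := hq.isProbabilityMeasure x' σ' hσ'
  by_cases hgood : σ ≤ 1 ∧ σ' ≤ 1
  · rw [pairBound, if_pos hgood]
    rw [hyx hgood.1, hyx' hgood.2] at hyy
    have hA := spread_pos (x := x) hC hσ
    have hA' := spread_pos (x := x') hC hσ'
    have habs := hq.lintegral_abs_le hC (x := x) hσ
    have habs' := hq.lintegral_abs_le hC (x := x') hσ'
    have hsec : ∫⁻ θ, ENNReal.ofReal ((θ - x) ^ 2) ∂q x σ ≤ ENNReal.ofReal (spread C x σ ^ 2) :=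
      hq.second_moment x σ hσ
    have hsec' : ∫⁻ θ, ENNReal.ofReal ((θ - x') ^ 2) ∂q x' σ' ≤
      ENNReal.ofReal (spread C x' σ' ^ 2) := hq.second_moment x' σ' hσ'
    set A := spread C x σ
    set A' := spread C x' σ'
    set S := 4 * (A ^ 2 + A' ^ 2) with hS
    have hSpos : 0 < S := by positivity
    rcases le_or_gt ((x - x') ^ 2) S with hg | hg
    · refine ⟨fun θ => ENNReal.ofReal 1 + ENNReal.ofReal 1 * ENNReal.ofReal |θ - x|,
        fun θ => ENNReal.ofReal 0 + ENNReal.ofReal 1 * ENNReal.ofReal |θ - x'|,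
        by fun_prop, by fun_prop, fun θ θ' hθ => ?_, ?_⟩
      · simp only [ENNReal.ofReal_one, ENNReal.ofReal_zero, one_mul, zero_add]
        rw [← ENNReal.ofReal_one, ← ENNReal.ofReal_add (by positivity) (by positivity),
          ← ENNReal.ofReal_add (by positivity) (by positivity)]
        refine ENNReal.ofReal_le_ofReal ?_
        linarith [neg_abs_le (θ - x), le_abs_self (θ' - x')]
      · refine (add_le_add
          (lintegral_add_mul_ofReal (by fun_prop) zero_le_one zero_le_one hA.le habs)
          (lintegral_add_mul_ofReal (by fun_prop) le_rfl zero_le_one hA'.le habs')).trans ?_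
        rw [← ENNReal.ofReal_add (by positivity) (by positivity)]
        refine ENNReal.ofReal_le_ofReal ?_
        have : 1 ≤ 2 * S / (S + (x - x') ^ 2) := by
          rw [one_le_div (by positivity)]; linarith
        linarith
    · have hg0 : 0 < (x - x') ^ 2 := hSpos.trans hg
      have hxx : 0 < x - x' := by
        refine lt_of_le_of_ne (by linarith) fun h => ?_
        rw [← h] at hg0; norm_num at hg0
      have hint : ∀ {w B : ℝ} {μ : Measure ℝ} [IsProbabilityMeasure μ], 0 < B →
          ∫⁻ θ, ENNReal.ofReal |θ - w| ∂μ ≤ ENNReal.ofReal B →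
          ∫⁻ θ, ENNReal.ofReal ((θ - w) ^ 2) ∂μ ≤ ENNReal.ofReal (B ^ 2) →
          ∫⁻ θ, (ENNReal.ofReal |θ - w| + ENNReal.ofReal (4 / (x - x') ^ 2) *
            ENNReal.ofReal ((θ - w) ^ 2)) ∂μ ≤
            ENNReal.ofReal (B + 4 / (x - x') ^ 2 * B ^ 2) := by
        intro w B μ _ hB h1 h2
        rw [lintegral_add_left (by fun_prop), lintegral_const_mul _ (by fun_prop),
          ENNReal.ofReal_add hB.le (by positivity), ENNReal.ofReal_mul (by positivity)]
        gcongr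
      refine ⟨fun θ => ENNReal.ofReal |θ - x| +
          ENNReal.ofReal (4 / (x - x') ^ 2) * ENNReal.ofReal ((θ - x) ^ 2),
        fun θ => ENNReal.ofReal |θ - x'| +
          ENNReal.ofReal (4 / (x - x') ^ 2) * ENNReal.ofReal ((θ - x') ^ 2),
        by fun_prop, by fun_prop, fun θ θ' hθ => ?_, ?_⟩
      · beta_reduce
        rw [← ENNReal.ofReal_mul (by positivity), ← ENNReal.ofReal_mul (by positivity),
          ← ENNReal.ofReal_add (by positivity) (by positivity),
          ← ENNReal.ofReal_add (by positivity) (by positivity),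
          ← ENNReal.ofReal_add (by positivity) (by positivity)]
        refine ENNReal.ofReal_le_ofReal ?_
        have h1 : 1 ≤ 4 / (x - x') ^ 2 * ((θ - x) ^ 2 + (θ' - x') ^ 2) := by
          rw [div_mul_eq_mul_div, one_le_div hg0]
          -- A misranked pair has one of the two deviations at least half the observed gap.
          have h2 : x - x' ≤ (θ' - x') - (θ - x) := by linarith
          nlinarith [sq_nonneg ((θ' - x') + (θ - x)), sq_nonneg (θ' - x'), sq_nonneg (θ - x)]
        nlinarith [neg_abs_le (θ - x), le_abs_self (θ' - x')]
      · refine (add_le_add (hint hA habs hsec)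
          (hint hA' habs' hsec')).trans ?_
        rw [← ENNReal.ofReal_add (by positivity) (by positivity)]
        refine ENNReal.ofReal_le_ofReal ?_
        have h1 : S / (x - x') ^ 2 ≤ 2 * S / (S + (x - x') ^ 2) := by
          rw [div_le_div_iff₀ hg0 (by positivity)]
          nlinarith
        have h2 : 4 / (x - x') ^ 2 * A ^ 2 + 4 / (x - x') ^ 2 * A' ^ 2 = S / (x - x') ^ 2 := by
          rw [hS]; ring
        linarith
  · rw [pairBound, if_neg hgood]
    have hx := abs_nonneg x
    have hx' := abs_nonneg x'
    set Q := 1 + σ + |x| with hQ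
    set Q' := 1 + σ' + |x'| with hQ'
    have hQ1 : 1 ≤ Q := by linarith
    have hQ1' : 1 ≤ Q' := by linarith
    have hC0 : 0 ≤ C := by linarith
    have hxx : |x| + |x'| ≤ 2 * (Q * Q') := by nlinarith
    have h1 : max (x - y) 0 ≤ (C + 2) * (Q * Q') := by
      refine score_excess_le hC0 hQ1 hQ1' ?_ ?_
      · linarith [neg_abs_le (y - x)]
      · linarith [neg_abs_le (y' - x'), le_abs_self x, neg_abs_le x']
    have h2 : max (y' - x') 0 ≤ (C + 2) * (Q * Q') := by
      rw [mul_comm Q]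
      refine score_excess_le hC0 hQ1' hQ1 ?_ ?_
      · linarith [le_abs_self (y' - x')]
      · linarith [le_abs_self (y - x), le_abs_self x, neg_abs_le x']
    have hm1 := le_max_right (x - y) 0
    have hm2 := le_max_right (y' - x') 0
    refine ⟨fun θ => ENNReal.ofReal (1 + (|x| + |x'|)) + ENNReal.ofReal 1 *
        ENNReal.ofReal (x - θ),
      fun θ => ENNReal.ofReal 0 + ENNReal.ofReal 1 * ENNReal.ofReal (θ - x'),
      by fun_prop, by fun_prop, fun θ θ' hθ => ?_, ?_⟩
    · simp only [ENNReal.ofReal_one, ENNReal.ofReal_zero, one_mul, zero_add]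
      refine (ENNReal.ofReal_le_ofReal (?_ : _ ≤ (1 + (|x| + |x'|) + (x - θ)) + (θ' - x'))).trans
        (ENNReal.ofReal_add_le.trans (by gcongr; exact ENNReal.ofReal_add_le))
      linarith [neg_abs_le x, le_abs_self x']
    · refine (add_le_add
          (lintegral_add_mul_ofReal (by fun_prop) (by positivity) zero_le_one (by positivity) hd)
          (lintegral_add_mul_ofReal (by fun_prop) le_rfl zero_le_one (by positivity) hu')).trans ?_
      rw [← ENNReal.ofReal_add (by positivity) (by positivity)]
      refine ENNReal.ofReal_le_ofReal ?_
      have h3 : C * Q + C * Q' ≤ 2 * C * (Q * Q') := by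
        have : C * (Q + Q') ≤ C * (2 * (Q * Q')) := by
          gcongr; nlinarith
        linarith
      nlinarith

/-! ### Near-optimality of the Bayesian ranking -/

theorem lintegral_pi_eval {p : ℕ} (μ : Fin p → Measure ℝ) [∀ i, IsProbabilityMeasure (μ i)]
    (i : Fin p) {f : ℝ → ℝ≥0∞} (hf : Measurable f) :
    ∫⁻ θ, f (θ i) ∂Measure.pi μ = ∫⁻ t, f t ∂μ i :=
  (measurePreserving_eval μ i).lintegral_comp hf

/-- Ranking the units by their scores gives a posterior loss bounded by the sum of the pair
bounds. -/
theorem Concentrated.exists_ranking {C : ℝ} {q : ℝ → ℝ → Measure ℝ} (hq : Concentrated C q)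
    (hC : 1 ≤ C) {l : ℝ → ℝ → ℝ} (hl : IsPairwiseLoss l) {c₀ : ℝ} (hc₀ : 0 < c₀)
    (hlu : ∀ x y, x < y → l x y ≤ c₀ * (1 + (y - x))) {p : ℕ} {x σ : Fin p → ℝ}
    (hσ : ∀ i, 0 < σ i) :
    ∃ τ : Equiv.Perm (Fin p),
      ∫⁻ θ, ∑ k, ∑ j ∈ Finset.Ioi k, ENNReal.ofReal (l (θ (τ.symm k)) (θ (τ.symm j)))
          ∂Measure.pi (fun i => q (x i) (σ i)) ≤
        ENNReal.ofReal c₀ *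
          ∑ i, ∑ j with j ≠ i, ENNReal.ofReal (pairBound C (x i) (σ i) (x j) (σ j)) := by
  have hP : ∀ i, IsProbabilityMeasure (q (x i) (σ i)) :=
    fun i => hq.isProbabilityMeasure _ _ (hσ i)
  choose y hy hyx hd hu using fun i => hq.exists_score hC (x := x i) (hσ i)
  set e := Tuple.sort fun i => -y i
  have hmono : Monotone ((fun i => -y i) ∘ e) := Tuple.monotone_sort _
  refine ⟨e.symm, ?_⟩
  rw [Equiv.symm_symm]
  have hpair : ∀ k j, j ∈ Finset.Ioi k → ∃ φ ψ : ℝ → ℝ≥0∞, Measurable φ ∧ Measurable ψ ∧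
      (∀ θ θ', θ < θ' → ENNReal.ofReal (1 + (θ' - θ)) ≤ φ θ + ψ θ') ∧
      ∫⁻ θ, φ θ ∂q (x (e k)) (σ (e k)) + ∫⁻ θ, ψ θ ∂q (x (e j)) (σ (e j)) ≤
        ENNReal.ofReal (pairBound C (x (e k)) (σ (e k)) (x (e j)) (σ (e j))) := by
    intro k j hkj
    refine hq.pair_loss_le hC (hσ _) (hσ _) (hy _) (hyx _) (hd _) (hy _) (hyx _) (hu _) ?_
    have := hmono (Finset.mem_Ioi.1 hkj).le
    simpa using this
  choose! φ ψ hφ hψ hle hint using hpair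
  calc ∫⁻ θ, ∑ k, ∑ j ∈ Finset.Ioi k, ENNReal.ofReal (l (θ (e k)) (θ (e j)))
          ∂Measure.pi (fun i => q (x i) (σ i))
      ≤ ∫⁻ θ, ∑ k, ∑ j ∈ Finset.Ioi k,
          ENNReal.ofReal c₀ * (φ k j (θ (e k)) + ψ k j (θ (e j)))
          ∂Measure.pi (fun i => q (x i) (σ i)) := by
        refine lintegral_mono fun θ => Finset.sum_le_sum fun k _ => Finset.sum_le_sum
          fun j hj => ?_
        rcases le_or_gt (θ (e j)) (θ (e k)) with h | h
        · rw [hl.1 _ _ h]; simp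
        · refine (ENNReal.ofReal_le_ofReal (hlu _ _ h)).trans ?_
          rw [ENNReal.ofReal_mul hc₀.le]
          gcongr
          exact hle k j hj _ _ h
    _ = ∑ k, ∑ j ∈ Finset.Ioi k, ENNReal.ofReal c₀ *
          (∫⁻ θ, φ k j θ ∂q (x (e k)) (σ (e k)) + ∫⁻ θ, ψ k j θ ∂q (x (e j)) (σ (e j))) := by
        have hm : ∀ k, ∀ j ∈ Finset.Ioi k, Measurable fun θ : Fin p → ℝ =>
            φ k j (θ (e k)) + ψ k j (θ (e j)) := fun k j hj =>
          ((hφ k j hj).comp (measurable_pi_apply _)).add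
            ((hψ k j hj).comp (measurable_pi_apply _))
        rw [lintegral_finsetSum _ fun k _ => Finset.measurable_sum _
          fun j hj => (hm k j hj).const_mul _]
        refine Finset.sum_congr rfl fun k _ => ?_
        rw [lintegral_finsetSum _ fun j hj => (hm k j hj).const_mul _]
        refine Finset.sum_congr rfl fun j hj => ?_
        rw [lintegral_const_mul _ (hm k j hj),
          lintegral_add_left (show Measurable fun θ : Fin p → ℝ => φ k j (θ (e k)) from
            (hφ k j hj).comp (measurable_pi_apply _)),
          lintegral_pi_eval _ _ (hφ k j hj), lintegral_pi_eval _ _ (hψ k j hj)]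
    _ ≤ ∑ k, ∑ j ∈ Finset.Ioi k, ENNReal.ofReal c₀ *
          ENNReal.ofReal (pairBound C (x (e k)) (σ (e k)) (x (e j)) (σ (e j))) := by
        refine Finset.sum_le_sum fun k _ => Finset.sum_le_sum fun j hj => ?_
        gcongr
        exact hint k j hj
    _ ≤ _ := by
        simp_rw [← Finset.mul_sum]
        exact mul_le_mul_right (sum_ranked_pairs_le e fun i j =>
          ENNReal.ofReal (pairBound C (x i) (σ i) (x j) (σ j))) _

/-- The Bayesian ranking loses only a constant factor compared to ranking by scores. Since a regular
loss is only equivalent to an additive one, optimality is used for the total loss and not for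
single pairs. -/
theorem IsBayesianRanking.sum_lintegral_le {π : ℝ → ℝ} {L : ℝ → ℝ → ℝ → ℝ}
    {R : (p : ℕ) → (Fin p → ℝ) → ℝ}
    {ρ : (p : ℕ) → (Fin p → ℝ) → (Fin p → ℝ) → Equiv.Perm (Fin p)}
    (hρ : IsBayesianRanking π L R ρ) {s' : ℕ → ℝ} (hR : RegularLoss s' R) {C : ℝ} (hC : 1 ≤ C)
    (hq : Concentrated C (posterior π L)) :
    ∃ a B : ℝ, 0 < a ∧ 0 < B ∧ ∀ p, 1 ≤ p → ∀ x σ : Fin p → ℝ, (∀ i, 0 < σ i) →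
      ∑ k, ∑ j ∈ Finset.Ioi k,
        ∫⁻ θ, ENNReal.ofReal (min (θ ((ρ p x σ).symm j) - θ ((ρ p x σ).symm k)) a)
          ∂Measure.pi (fun i => posterior π L (x i) (σ i)) ≤
      ENNReal.ofReal B *
        ∑ i, ∑ j with j ≠ i, ENNReal.ofReal (pairBound C (x i) (σ i) (x j) (σ j)) := by
  obtain ⟨hs, -, l, hl, hlr, c, u, hc, hcu, heq⟩ := hR
  obtain ⟨a, b, ha, hb, hlow⟩ := hlr.exists_lower_bound hl
  obtain ⟨c₀, hc₀, hup⟩ := hlr.exists_upper_bound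
  have hu : 0 < u := hc.trans hcu
  refine ⟨a, u / (b * c) * c₀, ha, by positivity, fun p hp x σ hσ => ?_⟩
  have hsp := hs p hp
  obtain ⟨τ, hτ⟩ := hq.exists_ranking hC hl hc₀ hup (x := x) hσ
  have hopt := hρ.2 p hp x σ hσ τ
  unfold posteriorLoss at hopt
  set μ := Measure.pi fun i => posterior π L (x i) (σ i)
  set e := (ρ p x σ).symm
  set S := ∑ i, ∑ j with j ≠ i, ENNReal.ofReal (pairBound C (x i) (σ i) (x j) (σ j))
  have hm : ∀ k j, Measurable fun θ : Fin p → ℝ =>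
      ENNReal.ofReal (min (θ (e j) - θ (e k)) a) := fun k j => by fun_prop
  have hlower : ENNReal.ofReal (s' p * b / u) * ∑ k, ∑ j ∈ Finset.Ioi k,
      ∫⁻ θ, ENNReal.ofReal (min (θ (e j) - θ (e k)) a) ∂μ ≤
      ∫⁻ θ, ENNReal.ofReal (R p fun k => θ (e k)) ∂μ := by
    have h1 : ∑ k, ∑ j ∈ Finset.Ioi k, ∫⁻ θ, ENNReal.ofReal (min (θ (e j) - θ (e k)) a) ∂μ =
        ∫⁻ θ, ∑ k, ∑ j ∈ Finset.Ioi k, ENNReal.ofReal (min (θ (e j) - θ (e k)) a) ∂μ := by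
      rw [lintegral_finsetSum _ fun k _ => Finset.measurable_sum _ fun j _ => hm k j]
      refine Finset.sum_congr rfl fun k _ => ?_
      rw [lintegral_finsetSum _ fun j _ => hm k j]
    rw [h1, ← lintegral_const_mul _ (Finset.measurable_sum _ fun k _ =>
      Finset.measurable_sum _ fun j _ => hm k j)]
    exact lintegral_mono fun θ =>
      le_ofReal_of_additiveLoss_le hu hb hlow hsp (heq p hp fun k => θ (e k)).2
  have hupper : ∫⁻ θ, ENNReal.ofReal (R p fun k => θ (τ.symm k)) ∂μ ≤
      ENNReal.ofReal (s' p / c) * (ENNReal.ofReal c₀ * S) := by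
    calc ∫⁻ θ, ENNReal.ofReal (R p fun k => θ (τ.symm k)) ∂μ
        ≤ ∫⁻ θ, ENNReal.ofReal (s' p / c) * ∑ k, ∑ j ∈ Finset.Ioi k,
            ENNReal.ofReal (l (θ (τ.symm k)) (θ (τ.symm j))) ∂μ :=
          lintegral_mono fun θ =>
            ofReal_le_of_le_additiveLoss hl hc hsp (heq p hp fun k => θ (τ.symm k)).1
      _ = ENNReal.ofReal (s' p / c) * ∫⁻ θ, ∑ k, ∑ j ∈ Finset.Ioi k,
            ENNReal.ofReal (l (θ (τ.symm k)) (θ (τ.symm j))) ∂μ :=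
          lintegral_const_mul' _ _ (by simp)
      _ ≤ _ := by gcongr
  have hkey := (hlower.trans hopt).trans hupper
  have hpos : 0 < s' p * b / u := by positivity
  refine (ENNReal.mul_le_mul_iff_right (ENNReal.ofReal_pos.2 hpos).ne' (by simp)).1
    (hkey.trans (le_of_eq ?_))
  rw [← mul_assoc, ← mul_assoc, ← ENNReal.ofReal_mul (by positivity),
    ← ENNReal.ofReal_mul (by positivity)]
  congr 2
  field_simp

/-- The size of the fluctuation of a unit with true value `θ`, standard deviation `σ` and
observation `x`; its expectation is of the order of the mean of `σ`. -/
def fluctuation (θ σ x : ℝ) : ℝ := σ + σ * |θ| + |x - θ|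

theorem fluctuation_nonneg {θ σ x : ℝ} (hσ : 0 < σ) : 0 ≤ fluctuation θ σ x := by
  unfold fluctuation; positivity

theorem spread_le_fluctuation {C θ σ x : ℝ} (hC : 1 ≤ C) (hσ : 0 < σ) (h1 : σ ≤ 1) :
    spread C x σ ≤ 2 * C * fluctuation θ σ x := by
  have hx : |x| ≤ |θ| + |x - θ| := by
    have := abs_add_le θ (x - θ)
    rwa [add_sub_cancel] at this
  have e : spread C x σ = C * (σ * (1 + |x| + σ)) := by unfold spread; ring
  rw [e, mul_comm 2 C, mul_assoc]
  refine mul_le_mul_of_nonneg_left ?_ (by linarith)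
  have h2 : σ * |x| ≤ σ * (|θ| + |x - θ|) := by gcongr
  have h3 : σ * |x - θ| ≤ 1 * |x - θ| := by gcongr
  have h4 : σ * σ ≤ σ * 1 := by gcongr
  have h5 : 0 ≤ σ * |θ| := by positivity
  have h6 := abs_nonneg (x - θ)
  unfold fluctuation
  nlinarith

/-- A gap between true values is, up to fluctuations, bounded by the posterior gap. -/
theorem Concentrated.min_sub_le {C : ℝ} {q : ℝ → ℝ → Measure ℝ} (hq : Concentrated C q)
    (hC : 1 ≤ C) {a : ℝ} (ha : 0 < a) {p : ℕ} {x σ θ : Fin p → ℝ} (hσ : ∀ i, 0 < σ i)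
    (i j : Fin p) :
    ENNReal.ofReal (min (θ j - θ i) a) ≤
      ∫⁻ t, ENNReal.ofReal (min (t j - t i) a) ∂Measure.pi (fun i => q (x i) (σ i)) +
      ENNReal.ofReal ((2 * C + 1 + a) *
        (fluctuation (θ i) (σ i) (x i) + fluctuation (θ j) (σ j) (x j))) := by
  have hP : ∀ i, IsProbabilityMeasure (q (x i) (σ i)) :=
    fun i => hq.isProbabilityMeasure _ _ (hσ i)
  set μ := Measure.pi fun i => q (x i) (σ i)
  have hU : ∀ i, 0 ≤ fluctuation (θ i) (σ i) (x i) := fun i => fluctuation_nonneg (hσ i)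
  have hUσ : ∀ i, σ i ≤ fluctuation (θ i) (σ i) (x i) := fun i => by
    have := hσ i
    have : 0 ≤ σ i * |θ i| := by positivity
    have := abs_nonneg (x i - θ i)
    unfold fluctuation; linarith
  have hUe : ∀ i, |x i - θ i| ≤ fluctuation (θ i) (σ i) (x i) := fun i => by
    have := hσ i
    have : 0 ≤ σ i * |θ i| := by positivity
    unfold fluctuation; linarith
  by_cases hgood : σ i ≤ 1 ∧ σ j ≤ 1
  · have hpt : ∀ t : Fin p → ℝ, ENNReal.ofReal (min (θ j - θ i) a) ≤
        ENNReal.ofReal (min (t j - t i) a) +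
          (ENNReal.ofReal (|x i - θ i| + |x j - θ j|) +
          (ENNReal.ofReal |t i - x i| + ENNReal.ofReal |t j - x j|)) := by
      intro t
      rw [← ENNReal.ofReal_add (abs_nonneg (t i - x i)) (abs_nonneg _),
        ← ENNReal.ofReal_add (by positivity) (by positivity)]
      refine le_trans (ENNReal.ofReal_le_ofReal ?_) ENNReal.ofReal_add_le
      set E := |x i - θ i| + |x j - θ j| + (|t i - x i| + |t j - x j|) with hE
      have hE0 : 0 ≤ E := by positivity
      rw [← sub_le_iff_le_add]
      refine le_min ?_ (by linarith [min_le_right (θ j - θ i) a])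
      have := min_le_left (θ j - θ i) a
      linarith [le_abs_self (x i - θ i), neg_abs_le (x j - θ j), le_abs_self (t i - x i),
        neg_abs_le (t j - x j)]
    calc ENNReal.ofReal (min (θ j - θ i) a)
        = ∫⁻ _, ENNReal.ofReal (min (θ j - θ i) a) ∂μ := by simp
      _ ≤ ∫⁻ t, (ENNReal.ofReal (min (t j - t i) a) +
          (ENNReal.ofReal (|x i - θ i| + |x j - θ j|) +
          (ENNReal.ofReal |t i - x i| + ENNReal.ofReal |t j - x j|))) ∂μ := lintegral_mono hpt
      _ = ∫⁻ t, ENNReal.ofReal (min (t j - t i) a) ∂μ +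
          (ENNReal.ofReal (|x i - θ i| + |x j - θ j|) +
          (∫⁻ t, ENNReal.ofReal |t - x i| ∂q (x i) (σ i) +
            ∫⁻ t, ENNReal.ofReal |t - x j| ∂q (x j) (σ j))) := by
          rw [lintegral_add_left (by fun_prop), lintegral_add_left measurable_const,
            lintegral_add_left (by fun_prop),
            lintegral_pi_eval _ i (f := fun t => ENNReal.ofReal |t - x i|) (by fun_prop),
            lintegral_pi_eval _ j (f := fun t => ENNReal.ofReal |t - x j|) (by fun_prop)]
          simp
      _ ≤ ∫⁻ t, ENNReal.ofReal (min (t j - t i) a) ∂μ +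
          (ENNReal.ofReal (|x i - θ i| + |x j - θ j|) +
          (ENNReal.ofReal (spread C (x i) (σ i)) + ENNReal.ofReal (spread C (x j) (σ j)))) := by
          gcongr
          · exact hq.lintegral_abs_le hC (hσ i)
          · exact hq.lintegral_abs_le hC (hσ j)
      _ ≤ _ := by
          have h1 := (spread_pos (x := x i) hC (hσ i)).le
          have h2 := (spread_pos (x := x j) hC (hσ j)).le
          rw [← ENNReal.ofReal_add h1 h2, ← ENNReal.ofReal_add (by positivity) (by positivity)]
          gcongr
          have h3 := spread_le_fluctuation (θ := θ i) (x := x i) hC (hσ i) hgood.1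
          have h4 := spread_le_fluctuation (θ := θ j) (x := x j) hC (hσ j) hgood.2
          have := mul_nonneg ha.le (add_nonneg (hU i) (hU j))
          linarith [hUe i, hUe j]
  · refine le_add_left (ENNReal.ofReal_le_ofReal ?_)
    have h1 : 1 ≤ fluctuation (θ i) (σ i) (x i) + fluctuation (θ j) (σ j) (x j) := by
      rw [not_and_or, not_le, not_le] at hgood
      rcases hgood with h | h
      · linarith [hUσ i, hU j]
      · linarith [hUσ j, hU i]
    have h2 := min_le_right (θ j - θ i) a
    nlinarith

/-- The total true loss of the Bayesian ranking, bounded by a sum over pairs of units that no longer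
involves the ranking. -/
theorem IsBayesianRanking.sum_loss_le {π : ℝ → ℝ} {L : ℝ → ℝ → ℝ → ℝ}
    {R : (p : ℕ) → (Fin p → ℝ) → ℝ}
    {ρ : (p : ℕ) → (Fin p → ℝ) → (Fin p → ℝ) → Equiv.Perm (Fin p)}
    (hρ : IsBayesianRanking π L R ρ) {s' : ℕ → ℝ} (hR : RegularLoss s' R) {C : ℝ} (hC : 1 ≤ C)
    (hq : Concentrated C (posterior π L)) {l : ℝ → ℝ → ℝ} (hl : IsPairwiseLoss l)
    (hlr : Restrained l) :
    ∃ B : ℝ, 0 < B ∧ ∀ η, 0 < η → η ≤ 1 → ∀ p, 1 ≤ p → ∀ θ x σ : Fin p → ℝ, (∀ i, 0 < σ i) →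
      ∑ k, ∑ j ∈ Finset.Ioi k,
        ENNReal.ofReal (l (θ ((ρ p x σ).symm k)) (θ ((ρ p x σ).symm j))) ≤
      ENNReal.ofReal B * ∑ i, ∑ j with j ≠ i,
        ((if |θ j - θ i| < η then 1 else 0) + ENNReal.ofReal (η * (θ j - θ i) ^ 2) +
          ENNReal.ofReal (1 / η) *
            (ENNReal.ofReal (fluctuation (θ i) (σ i) (x i) + fluctuation (θ j) (σ j) (x j)) +
              ENNReal.ofReal (pairBound C (x i) (σ i) (x j) (σ j)))) := by
  obtain ⟨a, B, ha, hB, hmain⟩ := hρ.sum_lintegral_le hR hC hq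
  obtain ⟨c₀, hc₀, hup⟩ := hlr.exists_upper_bound
  set c₁ := c₀ * (2 + a + 2 / a) with hc₁
  set c₂ := 1 + (2 * C + 1 + a) + B with hc₂
  have hc₁0 : 0 < c₁ := by positivity
  have hc₂0 : 1 ≤ c₂ := by
    have : 0 < (2 * C + 1 + a) + B := by positivity
    linarith
  refine ⟨c₁ * c₂, by positivity, fun η hη hη1 p hp θ x σ hσ => ?_⟩
  have hmain := hmain p hp x σ hσ
  set e := (ρ p x σ).symm
  set μ := Measure.pi fun i => posterior π L (x i) (σ i)
  set P : Fin p → Fin p → ℝ≥0∞ := fun i j =>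
    (if |θ j - θ i| < η then 1 else 0) + ENNReal.ofReal (η * (θ j - θ i) ^ 2) with hPdef
  set U : Fin p → Fin p → ℝ≥0∞ := fun i j =>
    ENNReal.ofReal (fluctuation (θ i) (σ i) (x i) + fluctuation (θ j) (σ j) (x j)) with hUdef
  set V : Fin p → Fin p → ℝ≥0∞ := fun i j =>
    ENNReal.ofReal (pairBound C (x i) (σ i) (x j) (σ j)) with hVdef
  set W : Fin p → Fin p → ℝ≥0∞ := fun k j =>
    ∫⁻ t, ENNReal.ofReal (min (t (e j) - t (e k)) a) ∂μ with hWdef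
  have hpair : ∀ k j, ENNReal.ofReal (l (θ (e k)) (θ (e j))) ≤ ENNReal.ofReal c₁ *
      ((P (e k) (e j) + ENNReal.ofReal (1 / η) * (ENNReal.ofReal (2 * C + 1 + a) *
        U (e k) (e j))) + ENNReal.ofReal (1 / η) * W k j) := by
    intro k j
    rcases le_or_gt (θ (e j)) (θ (e k)) with h | h
    · rw [hl.1 _ _ h]; simp
    set t := θ (e j) - θ (e k) with ht
    have ht0 : 0 < t := sub_pos.2 h
    have h1 : l (θ (e k)) (θ (e j)) ≤
        c₁ * ((if t < η then 1 else 0) + η * t ^ 2 + 1 / η * min t a) := by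
      refine (hup _ _ h).trans ?_
      rw [hc₁, mul_assoc]
      exact mul_le_mul_of_nonneg_left (one_add_le_of_scale ha hη hη1 ht0) hc₀.le
    refine (ENNReal.ofReal_le_ofReal h1).trans ?_
    have hind : (0 : ℝ) ≤ if t < η then 1 else 0 := by split_ifs <;> norm_num
    have hmin : 0 < min t a := lt_min ht0 ha
    rw [ENNReal.ofReal_mul hc₁0.le, ENNReal.ofReal_add (by positivity) (by positivity),
      ENNReal.ofReal_add hind (by positivity), ENNReal.ofReal_mul (p := 1 / η) (by positivity)]
    have h2 : ENNReal.ofReal (if t < η then 1 else 0) = if |t| < η then 1 else 0 := by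
      rw [abs_of_pos ht0]; split_ifs <;> simp
    have h3 := hq.min_sub_le hC ha (x := x) (θ := θ) hσ (e k) (e j)
    rw [ENNReal.ofReal_mul (by positivity)] at h3
    rw [h2, add_assoc (P _ _), ← mul_add]
    gcongr
    rw [add_comm]
    exact h3
  calc ∑ k, ∑ j ∈ Finset.Ioi k, ENNReal.ofReal (l (θ (e k)) (θ (e j)))
      ≤ ∑ k, ∑ j ∈ Finset.Ioi k, ENNReal.ofReal c₁ *
      ((P (e k) (e j) + ENNReal.ofReal (1 / η) * (ENNReal.ofReal (2 * C + 1 + a) *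
        U (e k) (e j))) + ENNReal.ofReal (1 / η) * W k j) :=
        Finset.sum_le_sum fun k _ => Finset.sum_le_sum fun j _ => hpair k j
    _ = ENNReal.ofReal c₁ * (∑ k, ∑ j ∈ Finset.Ioi k, (P (e k) (e j) +
          ENNReal.ofReal (1 / η) * (ENNReal.ofReal (2 * C + 1 + a) * U (e k) (e j))) +
        ENNReal.ofReal (1 / η) * ∑ k, ∑ j ∈ Finset.Ioi k, W k j) := by
        simp_rw [← Finset.mul_sum, Finset.sum_add_distrib, ← Finset.mul_sum]
    _ ≤ ENNReal.ofReal c₁ * (∑ i, ∑ j with j ≠ i, (P i j +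
          ENNReal.ofReal (1 / η) * (ENNReal.ofReal (2 * C + 1 + a) * U i j)) +
        ENNReal.ofReal (1 / η) * (ENNReal.ofReal B * ∑ i, ∑ j with j ≠ i, V i j)) := by
        refine mul_le_mul_right (add_le_add ?_ (mul_le_mul_right hmain _)) _
        exact sum_ranked_pairs_le e fun i j => P i j +
          ENNReal.ofReal (1 / η) * (ENNReal.ofReal (2 * C + 1 + a) * U i j)
    _ = ENNReal.ofReal c₁ * ∑ i, ∑ j with j ≠ i, (P i j + ENNReal.ofReal (1 / η) *
          (ENNReal.ofReal (2 * C + 1 + a) * U i j + ENNReal.ofReal B * V i j)) := by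
        simp_rw [Finset.mul_sum, ← Finset.sum_add_distrib, Finset.mul_sum]
        exact Finset.sum_congr rfl fun i _ => Finset.sum_congr rfl fun j _ => by ring
    _ ≤ ENNReal.ofReal c₁ * ∑ i, ∑ j with j ≠ i, (ENNReal.ofReal c₂ * (P i j +
          ENNReal.ofReal (1 / η) * (U i j + V i j))) := by
        gcongr with i _ j _
        have h1 : 1 ≤ ENNReal.ofReal c₂ := by simpa using hc₂0
        have h2 : ENNReal.ofReal (2 * C + 1 + a) ≤ ENNReal.ofReal c₂ :=
          ENNReal.ofReal_le_ofReal (by linarith)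
        have h3 : ENNReal.ofReal B ≤ ENNReal.ofReal c₂ :=
          ENNReal.ofReal_le_ofReal (by rw [hc₂]; linarith [show 0 < 2 * C + 1 + a by positivity])
        rw [mul_add (ENNReal.ofReal c₂), mul_left_comm (ENNReal.ofReal c₂),
          mul_add (ENNReal.ofReal c₂) (U i j)]
        gcongr
        exact le_mul_of_one_le_left zero_le h1
    _ = _ := by
        simp_rw [← Finset.mul_sum]
        rw [← mul_assoc, ← ENNReal.ofReal_mul hc₁0.le]

/-! ### Expectations over one unit -/

theorem IsErrorModel.lintegral_sq_le {g : Kernel (ℝ × ℝ) ℝ} [IsMarkovKernel g] {ν : Measure ℝ}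
    {L : ℝ → ℝ → ℝ → ℝ} (hg : IsErrorModel g ν L) (θ : ℝ) {σ : ℝ} (hσ : 0 < σ) :
    ∫⁻ x, ENNReal.ofReal ((x - θ) ^ 2) ∂g (θ, σ) ≤ ENNReal.ofReal (σ ^ 2) := by
  have hm : MemLp (fun x => x - θ) 2 (g (θ, σ)) := (hg.memLp θ σ hσ).sub (memLp_const θ)
  rw [← ofReal_integral_eq_lintegral_ofReal hm.integrable_sq (ae_of_all _ fun x => sq_nonneg _),
    hg.variance θ σ hσ]

theorem IsErrorModel.lintegral_abs_le {g : Kernel (ℝ × ℝ) ℝ} [IsMarkovKernel g] {ν : Measure ℝ}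
    {L : ℝ → ℝ → ℝ → ℝ} (hg : IsErrorModel g ν L) (θ : ℝ) {σ : ℝ} (hσ : 0 < σ) :
    ∫⁻ x, ENNReal.ofReal |x - θ| ∂g (θ, σ) ≤ ENNReal.ofReal σ := by
  have h := lintegral_abs_sub_le (q := g (θ, σ)) (x := θ) hσ zero_le_one
    (by rw [one_mul]; exact hg.lintegral_sq_le θ hσ)
  norm_num at h
  exact h

theorem lintegral_ofReal_id_eq {h : Measure ℝ} (hpos : ∀ᵐ t ∂h, 0 < t) (hint : Integrable id h) :
    ∫⁻ t, ENNReal.ofReal t ∂h = ENNReal.ofReal (∫ t, t ∂h) :=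
  (ofReal_integral_eq_lintegral_ofReal hint (by filter_upwards [hpos] with t ht using ht.le)).symm

theorem ae_pos_compProd {μ h : Measure ℝ} [IsProbabilityMeasure μ] [IsProbabilityMeasure h]
    {g : Kernel (ℝ × ℝ) ℝ} [IsMarkovKernel g] (hpos : ∀ᵐ t ∂h, 0 < t) :
    ∀ᵐ w ∂(μ.prod h) ⊗ₘ g, 0 < w.1.2 := by
  rw [Measure.ae_compProd_iff (measurableSet_lt measurable_const (by fun_prop))]
  filter_upwards [Measure.quasiMeasurePreserving_snd.ae hpos] with z hz
  exact ae_of_all _ fun _ => hz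

theorem lintegral_fluctuation_le {μ h : Measure ℝ} [IsProbabilityMeasure μ]
    [IsProbabilityMeasure h] {g : Kernel (ℝ × ℝ) ℝ} [IsMarkovKernel g] {ν : Measure ℝ}
    {L : ℝ → ℝ → ℝ → ℝ} (hg : IsErrorModel g ν L) (hμ : Integrable id μ)
    (hpos : ∀ᵐ t ∂h, 0 < t) (hint : Integrable id h) :
    ∫⁻ w, ENNReal.ofReal (fluctuation w.1.1 w.1.2 w.2) ∂(μ.prod h) ⊗ₘ g ≤
      ENNReal.ofReal ((2 + ∫ t, |t| ∂μ) * ∫ t, t ∂h) := by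
  have hae : ∀ᵐ z ∂μ.prod h, 0 < z.2 := Measure.quasiMeasurePreserving_snd.ae hpos
  unfold fluctuation
  rw [Measure.lintegral_compProd (by fun_prop)]
  calc ∫⁻ z, ∫⁻ x, ENNReal.ofReal (z.2 + z.2 * |z.1| + |x - z.1|) ∂g z ∂μ.prod h
      ≤ ∫⁻ z, ENNReal.ofReal (2 + |z.1|) * ENNReal.ofReal z.2 ∂μ.prod h := by
        refine lintegral_mono_ae ?_
        filter_upwards [hae] with z hz
        calc ∫⁻ x, ENNReal.ofReal (z.2 + z.2 * |z.1| + |x - z.1|) ∂g z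
            = ENNReal.ofReal (z.2 + z.2 * |z.1|) + ∫⁻ x, ENNReal.ofReal |x - z.1| ∂g z := by
              have : ∀ x, ENNReal.ofReal (z.2 + z.2 * |z.1| + |x - z.1|) =
                  ENNReal.ofReal (z.2 + z.2 * |z.1|) + ENNReal.ofReal |x - z.1| := fun x =>
                ENNReal.ofReal_add (by positivity) (by positivity)
              simp_rw [this]
              rw [lintegral_add_left measurable_const]; simp
          _ ≤ ENNReal.ofReal (z.2 + z.2 * |z.1|) + ENNReal.ofReal z.2 := by
              gcongr
              exact hg.lintegral_abs_le z.1 hz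
          _ = _ := by
              rw [← ENNReal.ofReal_add (by positivity) hz.le,
                ← ENNReal.ofReal_mul (by positivity)]
              congr 1; ring
    _ = (∫⁻ t, ENNReal.ofReal (2 + |t|) ∂μ) * ∫⁻ t, ENNReal.ofReal t ∂h :=
        lintegral_prod_mul (f := fun t => ENNReal.ofReal (2 + |t|)) (by fun_prop) (by fun_prop)
    _ = _ := by
        have h0 : 0 ≤ ∫ t, |t| ∂μ := integral_nonneg fun t => abs_nonneg t
        rw [lintegral_ofReal_id_eq hpos hint, ENNReal.ofReal_mul (by positivity)]
        congr 1
        have hi : Integrable (fun t : ℝ => 2 + |t|) μ := (integrable_const 2).add hμ.abs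
        rw [← ofReal_integral_eq_lintegral_ofReal hi (ae_of_all _ fun t => by positivity),
          integral_add (f := fun _ => (2 : ℝ)) (g := fun t => |t|) (integrable_const 2) hμ.abs]
        simp

theorem HasBoundedDensity.exists_lintegral_le {μ : Measure ℝ} (hμ : HasBoundedDensity μ) :
    ∃ c : ℝ, 0 ≤ c ∧ ∀ f : ℝ → ℝ≥0∞, ∫⁻ t, f t ∂μ ≤ ENNReal.ofReal c * ∫⁻ t, f t := by
  obtain ⟨φ, c, hφ, hb, rfl⟩ := hμ
  refine ⟨c, (hb 0).1.trans (hb 0).2, fun f => ?_⟩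
  rw [lintegral_withDensity_eq_lintegral_mul_non_measurable _ hφ.ennreal_ofReal (by simp),
    ← lintegral_const_mul' _ _ (by simp)]
  refine lintegral_mono fun t => ?_
  rw [Pi.mul_apply]
  gcongr
  exact (hb t).2

/-- The Cauchy kernel of scale `t`. -/
noncomputable def cauchyKernel (t d : ℝ) : ℝ := t ^ 2 / (t ^ 2 + d ^ 2)

theorem cauchyKernel_nonneg (t d : ℝ) : 0 ≤ cauchyKernel t d := by
  unfold cauchyKernel; positivity

theorem lintegral_cauchyKernel {t : ℝ} (ht : 0 < t) (y : ℝ) :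
    ∫⁻ θ, ENNReal.ofReal (cauchyKernel t (y - θ)) = ENNReal.ofReal (Real.pi * t) := by
  have e : ∀ θ, cauchyKernel t (y - θ) = (1 + ((θ - y) / t) ^ 2)⁻¹ := fun θ => by
    unfold cauchyKernel
    have : t ^ 2 + (y - θ) ^ 2 ≠ 0 := by positivity
    have : t ^ 2 + (θ - y) ^ 2 ≠ 0 := by positivity
    field_simp
    ring
  have hi : Integrable fun θ => (1 + ((θ - y) / t) ^ 2)⁻¹ :=
    (integrable_inv_one_add_sq.comp_div ht.ne').comp_sub_right y
  simp_rw [e]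
  rw [← ofReal_integral_eq_lintegral_ofReal hi (ae_of_all _ fun θ => by positivity),
    integral_sub_right_eq_self (fun θ => (1 + (θ / t) ^ 2)⁻¹) y,
    Measure.integral_comp_div (fun θ => (1 + θ ^ 2)⁻¹) t, integral_univ_inv_one_add_sq,
    abs_of_pos ht, smul_eq_mul, mul_comm]

/-! ### Expectations over pairs of units -/

/-- A bound for the Chebyshev estimate of the probability that the order of two observations is
reversed in the posterior, which separates the observation `x` of the first unit from the true
value `θ'` of the second one: the observed gap is at least half of `x - θ'` unless the error
`x' - θ'` is large. -/
noncomputable def reversalBound (C θ σ x θ' σ' x' : ℝ) : ℝ :=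
  2 * cauchyKernel (8 * C * fluctuation θ σ x) (x - θ') +
    8 / (4 * σ' ^ 2 + (x - θ') ^ 2) * (σ' ^ 2 + (x' - θ') ^ 2)

theorem reversalBound_nonneg (C θ σ x θ' σ' x' : ℝ) : 0 ≤ reversalBound C θ σ x θ' σ' x' := by
  have := cauchyKernel_nonneg (8 * C * fluctuation θ σ x) (x - θ')
  unfold reversalBound
  positivity

theorem chebyshev_le_reversalBound {C θ σ x θ' σ' x' A : ℝ} (hA : 0 < A) (hσ' : 0 < σ')
    (hAU : A ≤ 2 * C * fluctuation θ σ x) :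
    2 * (4 * A ^ 2) / (4 * A ^ 2 + (x - x') ^ 2) ≤ reversalBound C θ σ x θ' σ' x' := by
  set d := x - θ' with hd
  set V := 2 * C * fluctuation θ σ x with hV
  have hV0 : 0 < V := hA.trans_le hAU
  have hAV : A ^ 2 ≤ V ^ 2 := pow_le_pow_left₀ hA.le hAU 2
  have hle2 : 2 * (4 * A ^ 2) / (4 * A ^ 2 + (x - x') ^ 2) ≤ 2 := by
    rw [div_le_iff₀ (by positivity)]
    nlinarith [sq_nonneg (x - x')]
  have e : cauchyKernel (8 * C * fluctuation θ σ x) d = 16 * V ^ 2 / (16 * V ^ 2 + d ^ 2) := by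
    unfold cauchyKernel
    rw [hV]
    congr 1 <;> ring
  have hk := cauchyKernel_nonneg (8 * C * fluctuation θ σ x) d
  unfold reversalBound
  rcases le_or_gt (d ^ 2) (4 * (x' - θ') ^ 2) with h | h
  · have : 2 ≤ 8 / (4 * σ' ^ 2 + d ^ 2) * (σ' ^ 2 + (x' - θ') ^ 2) := by
      rw [div_mul_eq_mul_div, le_div_iff₀ (by positivity)]
      nlinarith [sq_nonneg σ']
    linarith
  · have hg : d ^ 2 ≤ 4 * (x - x') ^ 2 := by
      have h1 : |2 * (x' - θ')| < |d| := by
        rw [← sq_lt_sq]; nlinarith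
      have h2 : |d| ≤ |2 * (x - x')| := by
        have e1 : 2 * d = 2 * (x - x') + 2 * (x' - θ') := by rw [hd]; ring
        have h3 := abs_add_le (2 * (x - x')) (2 * (x' - θ'))
        rw [← e1, abs_mul 2 d, abs_two] at h3
        linarith
      have := sq_le_sq.2 h2
      nlinarith
    have h1 : 2 * (4 * A ^ 2) / (4 * A ^ 2 + (x - x') ^ 2) ≤
        2 * cauchyKernel (8 * C * fluctuation θ σ x) d := by
      rw [e, ← mul_div_assoc, div_le_div_iff₀ (by positivity) (by positivity)]
      nlinarith [mul_le_mul hAV hg (sq_nonneg d) (sq_nonneg V), mul_le_mul_of_nonneg_left hg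
        (sq_nonneg A), mul_le_mul_of_nonneg_right hAV (sq_nonneg (x - x'))]
    have : 0 ≤ 8 / (4 * σ' ^ 2 + d ^ 2) * (σ' ^ 2 + (x' - θ') ^ 2) := by positivity
    linarith

/-- The pair bound in terms of quantities whose expectations factor over the two units. -/
theorem pairBound_le {C θ σ x θ' σ' x' : ℝ} (hC : 1 ≤ C) (hσ : 0 < σ) (hσ' : 0 < σ') :
    pairBound C x σ x' σ' ≤
      (8 * C + 14) * (fluctuation θ σ x * (1 + |θ'| + fluctuation θ' σ' x')) +
      (8 * C + 14) * (fluctuation θ' σ' x' * (1 + |θ| + fluctuation θ σ x)) +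
      (reversalBound C θ σ x θ' σ' x' + reversalBound C θ' σ' x' θ σ x) := by
  have hU := fluctuation_nonneg (θ := θ) (x := x) hσ
  have hU' := fluctuation_nonneg (θ := θ') (x := x') hσ'
  have hH := reversalBound_nonneg C θ σ x θ' σ' x'
  have hH' := reversalBound_nonneg C θ' σ' x' θ σ x
  by_cases hgood : σ ≤ 1 ∧ σ' ≤ 1
  · rw [pairBound, if_pos hgood]
    have hA := spread_pos (x := x) hC hσ
    have hA' := spread_pos (x := x') hC hσ'
    have hAU := spread_le_fluctuation (θ := θ) (x := x) hC hσ hgood.1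
    have hAU' := spread_le_fluctuation (θ := θ') (x := x') hC hσ' hgood.2
    have h1 := chebyshev_le_reversalBound (θ' := θ') (x' := x') hA hσ' hAU
    have h2 := chebyshev_le_reversalBound (θ' := θ) (x' := x) hA' hσ hAU'
    set A := spread C x σ
    set A' := spread C x' σ'
    set U := fluctuation θ σ x
    set U' := fluctuation θ' σ' x'
    have h3 : 2 * (4 * (A ^ 2 + A' ^ 2)) / (4 * (A ^ 2 + A' ^ 2) + (x - x') ^ 2) ≤
        2 * (4 * A ^ 2) / (4 * A ^ 2 + (x - x') ^ 2) +
        2 * (4 * A' ^ 2) / (4 * A' ^ 2 + (x' - x) ^ 2) := by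
      have e : 2 * (4 * (A ^ 2 + A' ^ 2)) / (4 * (A ^ 2 + A' ^ 2) + (x - x') ^ 2) =
          2 * (4 * A ^ 2) / (4 * (A ^ 2 + A' ^ 2) + (x - x') ^ 2) +
          2 * (4 * A' ^ 2) / (4 * (A ^ 2 + A' ^ 2) + (x - x') ^ 2) := by ring
      rw [e, show (x' - x) ^ 2 = (x - x') ^ 2 by ring]
      gcongr <;> nlinarith [sq_nonneg A, sq_nonneg A']
    have h4 : 2 * C * U ≤ (8 * C + 14) * (U * (1 + |θ'| + U')) := by
      have : 2 * C * U * 1 ≤ (8 * C + 14) * U * (1 + |θ'| + U') := by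
        gcongr
        · linarith
        · linarith [abs_nonneg θ']
      linarith
    have h5 : 2 * C * U' ≤ (8 * C + 14) * (U' * (1 + |θ| + U)) := by
      have : 2 * C * U' * 1 ≤ (8 * C + 14) * U' * (1 + |θ| + U) := by
        gcongr
        · linarith
        · linarith [abs_nonneg θ]
      linarith
    linarith
  · rw [pairBound, if_neg hgood]
    have key : ∀ {θ σ x : ℝ}, 0 < σ → 1 + σ + |x| ≤ 1 + |θ| + fluctuation θ σ x ∧
        (1 < σ → 1 + σ + |x| ≤ 2 * fluctuation θ σ x) := by
      intro θ σ x hσ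
      have hx : |x| ≤ |θ| + |x - θ| := by
        have := abs_add_le θ (x - θ)
        rwa [add_sub_cancel] at this
      have h1 : 0 ≤ σ * |θ| := by positivity
      unfold fluctuation
      refine ⟨by linarith, fun h => ?_⟩
      have h2 : 1 * |θ| ≤ σ * |θ| := by gcongr
      linarith [abs_nonneg (x - θ)]
    have hQ := (key (θ := θ) (x := x) hσ).1
    have hQ' := (key (θ := θ') (x := x') hσ').1
    have hQ1 := (key (θ := θ) (x := x) hσ).2
    have hQ1' := (key (θ := θ') (x := x') hσ').2
    set U := fluctuation θ σ x
    set U' := fluctuation θ' σ' x'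
    have n1 : 0 ≤ (8 * C + 14) * (U * (1 + |θ'| + U')) := by positivity
    have n2 : 0 ≤ (8 * C + 14) * (U' * (1 + |θ| + U)) := by positivity
    rw [not_and_or, not_le, not_le] at hgood
    rcases hgood with h | h
    · have : (1 + σ + |x|) * (1 + σ' + |x'|) ≤ 2 * U * (1 + |θ'| + U') :=
        mul_le_mul (hQ1 h) hQ' (by positivity) (by positivity)
      nlinarith
    · have : (1 + σ' + |x'|) * (1 + σ + |x|) ≤ 2 * U' * (1 + |θ| + U) :=
        mul_le_mul (hQ1' h) hQ (by positivity) (by positivity)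
      nlinarith

theorem measurable_reversalBound (C : ℝ) : Measurable fun z : ((ℝ × ℝ) × ℝ) × ((ℝ × ℝ) × ℝ) =>
    reversalBound C z.1.1.1 z.1.1.2 z.1.2 z.2.1.1 z.2.1.2 z.2.2 := by
  unfold reversalBound cauchyKernel fluctuation
  fun_prop

/-- Integrating out the error of the second observation in the reversal bound. -/
theorem IsErrorModel.lintegral_reversalBound_le {g : Kernel (ℝ × ℝ) ℝ} [IsMarkovKernel g]
    {ν : Measure ℝ} {L : ℝ → ℝ → ℝ → ℝ} (hg : IsErrorModel g ν L) (C θ σ x θ' : ℝ) {σ' : ℝ}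
    (hσ' : 0 < σ') :
    ∫⁻ x', ENNReal.ofReal (reversalBound C θ σ x θ' σ' x') ∂g (θ', σ') ≤
      ENNReal.ofReal (2 * cauchyKernel (8 * C * fluctuation θ σ x) (x - θ')) +
        ENNReal.ofReal (4 * cauchyKernel (2 * σ') (x - θ')) := by
  have hk := cauchyKernel_nonneg (8 * C * fluctuation θ σ x) (x - θ')
  have hden : 0 < 4 * σ' ^ 2 + (x - θ') ^ 2 := by positivity
  calc ∫⁻ x', ENNReal.ofReal (reversalBound C θ σ x θ' σ' x') ∂g (θ', σ')
      = ∫⁻ x', (ENNReal.ofReal (2 * cauchyKernel (8 * C * fluctuation θ σ x) (x - θ')) +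
          ENNReal.ofReal (8 / (4 * σ' ^ 2 + (x - θ') ^ 2)) *
            (ENNReal.ofReal (σ' ^ 2) + ENNReal.ofReal ((x' - θ') ^ 2))) ∂g (θ', σ') := by
        refine lintegral_congr fun x' => ?_
        rw [reversalBound, ENNReal.ofReal_add (by positivity) (by positivity),
          ENNReal.ofReal_mul (p := 8 / (4 * σ' ^ 2 + (x - θ') ^ 2)) (by positivity),
          ENNReal.ofReal_add (sq_nonneg _) (sq_nonneg _)]
    _ = ENNReal.ofReal (2 * cauchyKernel (8 * C * fluctuation θ σ x) (x - θ')) +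
          ENNReal.ofReal (8 / (4 * σ' ^ 2 + (x - θ') ^ 2)) *
            (ENNReal.ofReal (σ' ^ 2) +
              ∫⁻ x', ENNReal.ofReal ((x' - θ') ^ 2) ∂g (θ', σ')) := by
        rw [lintegral_add_left measurable_const, lintegral_const_mul _ (by fun_prop),
          lintegral_add_left measurable_const]
        simp
    _ ≤ ENNReal.ofReal (2 * cauchyKernel (8 * C * fluctuation θ σ x) (x - θ')) +
          ENNReal.ofReal (8 / (4 * σ' ^ 2 + (x - θ') ^ 2)) *
            (ENNReal.ofReal (σ' ^ 2) + ENNReal.ofReal (σ' ^ 2)) := by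
        gcongr
        exact hg.lintegral_sq_le θ' hσ'
    _ = _ := by
        rw [← ENNReal.ofReal_add (sq_nonneg _) (sq_nonneg _),
          ← ENNReal.ofReal_mul (by positivity)]
        congr 2
        unfold cauchyKernel
        rw [mul_pow]
        norm_num
        field_simp
        ring

theorem lintegral_mul_cauchyKernel_le {μ : Measure ℝ} {c : ℝ} (hc : 0 ≤ c)
    (hμ : ∀ f : ℝ → ℝ≥0∞, ∫⁻ t, f t ∂μ ≤ ENNReal.ofReal c * ∫⁻ t, f t) (x : ℝ) {t k : ℝ}
    (ht : 0 < t) (hk : 0 ≤ k) :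
    ∫⁻ s, ENNReal.ofReal (k * cauchyKernel t (x - s)) ∂μ ≤
      ENNReal.ofReal (k * (c * (Real.pi * t))) := by
  have e : ∀ s, ENNReal.ofReal (k * cauchyKernel t (x - s)) =
    ENNReal.ofReal k * ENNReal.ofReal (cauchyKernel t (x - s)) := fun s =>
      ENNReal.ofReal_mul hk
  simp_rw [e]
  rw [lintegral_const_mul' _ _ (by simp), ENNReal.ofReal_mul hk, ENNReal.ofReal_mul hc,
    ← lintegral_cauchyKernel ht x]
  exact mul_le_mul_right (hμ _) _

/-- Expectation of the reversal bound over the second unit: the error of the second observation is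
integrated out first, then its true value, which has a bounded density. -/
theorem lintegral_reversalBound_le {μ h : Measure ℝ} [IsProbabilityMeasure μ]
    [IsProbabilityMeasure h] {g : Kernel (ℝ × ℝ) ℝ} [IsMarkovKernel g] {ν : Measure ℝ}
    {L : ℝ → ℝ → ℝ → ℝ} (hg : IsErrorModel g ν L) {c : ℝ} (hc : 0 ≤ c)
    (hμ : ∀ f : ℝ → ℝ≥0∞, ∫⁻ t, f t ∂μ ≤ ENNReal.ofReal c * ∫⁻ t, f t)
    (hpos : ∀ᵐ t ∂h, 0 < t) (hint : Integrable id h) {C θ σ x : ℝ} (hC : 1 ≤ C) (hσ : 0 < σ) :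
    ∫⁻ w, ENNReal.ofReal (reversalBound C θ σ x w.1.1 w.1.2 w.2) ∂(μ.prod h) ⊗ₘ g ≤
      ENNReal.ofReal (16 * Real.pi * c * C * fluctuation θ σ x + 8 * Real.pi * c * ∫ t, t ∂h) := by
  have hae : ∀ᵐ z ∂μ.prod h, 0 < z.2 := Measure.quasiMeasurePreserving_snd.ae hpos
  have hU : 0 < fluctuation θ σ x := by unfold fluctuation; positivity
  have hm : Measurable fun w : (ℝ × ℝ) × ℝ => reversalBound C θ σ x w.1.1 w.1.2 w.2 :=
    by unfold reversalBound cauchyKernel fluctuation; fun_prop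
  have hmean : 0 ≤ ∫ t, t ∂h :=
    integral_nonneg_of_ae (by filter_upwards [hpos] with t ht using ht.le)
  rw [Measure.lintegral_compProd hm.ennreal_ofReal]
  set U := fluctuation θ σ x with hUdef
  calc ∫⁻ z, ∫⁻ x', ENNReal.ofReal (reversalBound C θ σ x z.1 z.2 x') ∂g z ∂μ.prod h
      ≤ ∫⁻ z, (ENNReal.ofReal (2 * cauchyKernel (8 * C * U) (x - z.1)) +
          ENNReal.ofReal (4 * cauchyKernel (2 * z.2) (x - z.1))) ∂μ.prod h := by
        refine lintegral_mono_ae ?_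
        filter_upwards [hae] with z hz
        exact hg.lintegral_reversalBound_le C θ σ x z.1 hz
    _ = ∫⁻ t, ∫⁻ s, (ENNReal.ofReal (2 * cauchyKernel (8 * C * U) (x - s)) +
          ENNReal.ofReal (4 * cauchyKernel (2 * t) (x - s))) ∂μ ∂h :=
        lintegral_prod_symm _ (by unfold cauchyKernel; fun_prop)
    _ ≤ ∫⁻ t, (ENNReal.ofReal (2 * (c * (Real.pi * (8 * C * U)))) +
          ENNReal.ofReal (8 * Real.pi * c) * ENNReal.ofReal t) ∂h := by
        refine lintegral_mono_ae ?_
        filter_upwards [hpos] with t ht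
        rw [lintegral_add_left (by unfold cauchyKernel; fun_prop)]
        refine add_le_add (lintegral_mul_cauchyKernel_le hc hμ x (by positivity) (by norm_num)) ?_
        refine (lintegral_mul_cauchyKernel_le hc hμ x (by positivity) (by norm_num)).trans
          (le_of_eq ?_)
        rw [← ENNReal.ofReal_mul (by positivity)]
        congr 1; ring
    _ = _ := by
        rw [lintegral_add_left measurable_const, lintegral_const_mul _ (by fun_prop),
          lintegral_ofReal_id_eq hpos hint, ← ENNReal.ofReal_mul (by positivity),
          lintegral_const, measure_univ, mul_one,
          ← ENNReal.ofReal_add (by positivity) (by positivity)]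
        congr 1; ring

theorem integral_pos_of_ae_pos {h : Measure ℝ} [IsProbabilityMeasure h]
    (hpos : ∀ᵐ t ∂h, 0 < t) (hint : Integrable id h) : 0 < ∫ t, t ∂h := by
  have h0 : 0 ≤ᵐ[h] fun t => t := by filter_upwards [hpos] with t ht using ht.le
  refine (integral_pos_iff_support_of_nonneg_ae h0 hint).2 ?_
  have hsupp : (Function.support fun t : ℝ => t) =ᵐ[h] Set.univ :=
    eventuallyEq_univ.2 (by filter_upwards [hpos] with t ht using ht.ne')
  rw [measure_congr hsupp, measure_univ]
  exact one_pos

theorem lintegral_true_value {μ h : Measure ℝ} [IsProbabilityMeasure μ] [IsProbabilityMeasure h]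
    {g : Kernel (ℝ × ℝ) ℝ} [IsMarkovKernel g] {f : ℝ → ℝ≥0∞} (hf : Measurable f) :
    ∫⁻ w, f w.1.1 ∂(μ.prod h) ⊗ₘ g = ∫⁻ t, f t ∂μ := by
  rw [Measure.lintegral_compProd (by fun_prop)]
  simp only [lintegral_const, measure_univ, mul_one]
  exact measurePreserving_fst.lintegral_comp hf

theorem lintegral_prod_fst {α : Type*} [MeasurableSpace α] {Λ : Measure α}
    [IsProbabilityMeasure Λ] {f : α → ℝ≥0∞} (hf : Measurable f) :
    ∫⁻ z, f z.1 ∂Λ.prod Λ = ∫⁻ w, f w ∂Λ :=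
  measurePreserving_fst.lintegral_comp hf

theorem lintegral_prod_snd {α : Type*} [MeasurableSpace α] {Λ : Measure α}
    [IsProbabilityMeasure Λ] {f : α → ℝ≥0∞} (hf : Measurable f) :
    ∫⁻ z, f z.2 ∂Λ.prod Λ = ∫⁻ w, f w ∂Λ :=
  measurePreserving_snd.lintegral_comp hf

theorem measurable_fluctuation :
    Measurable fun w : (ℝ × ℝ) × ℝ => fluctuation w.1.1 w.1.2 w.2 := by
  unfold fluctuation; fun_prop

theorem measurable_pairBound (C : ℝ) : Measurable fun z : ((ℝ × ℝ) × ℝ) × ((ℝ × ℝ) × ℝ) =>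
    pairBound C z.1.2 z.1.1.2 z.2.2 z.2.1.2 := by
  unfold pairBound spread
  refine Measurable.ite ?_ (by fun_prop) (by fun_prop)
  exact (measurableSet_le (f := fun z : ((ℝ × ℝ) × ℝ) × ((ℝ × ℝ) × ℝ) => z.1.1.2)
    (by fun_prop) measurable_const).inter
    (measurableSet_le (f := fun z : ((ℝ × ℝ) × ℝ) × ((ℝ × ℝ) × ℝ) => z.2.1.2)
      (by fun_prop) measurable_const)

/-- The expected pair bound is of the order of the mean standard deviation. -/
theorem exists_lintegral_pairBound_le {μ : Measure ℝ} [IsProbabilityMeasure μ]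
    {g : Kernel (ℝ × ℝ) ℝ} [IsMarkovKernel g] {ν : Measure ℝ}
    {L : ℝ → ℝ → ℝ → ℝ} (hg : IsErrorModel g ν L) (hμd : HasBoundedDensity μ)
    (hμ : Integrable id μ) {C : ℝ} (hC : 1 ≤ C) :
    ∃ B : ℝ, 0 ≤ B ∧ ∀ h : Measure ℝ, IsProbabilityMeasure h → (∀ᵐ t ∂h, 0 < t) →
      Integrable id h → ∫ t, t ∂h ≤ 1 →
      ∫⁻ z, ENNReal.ofReal (pairBound C z.1.2 z.1.1.2 z.2.2 z.2.1.2)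
          ∂((μ.prod h) ⊗ₘ g).prod ((μ.prod h) ⊗ₘ g) ≤
        ENNReal.ofReal (B * ∫ t, t ∂h) := by
  obtain ⟨c, hc, hcμ⟩ := hμd.exists_lintegral_le
  set c₁ := 2 + ∫ t, |t| ∂μ with hc₁
  have hμ0 : 0 ≤ ∫ t, |t| ∂μ := integral_nonneg fun t => abs_nonneg t
  have hc₁0 : 0 ≤ c₁ := by positivity
  have hpi := Real.pi_pos
  refine ⟨2 * ((8 * C + 14) * (c₁ * (2 * c₁))) +
    2 * (16 * Real.pi * c * C * c₁ + 8 * Real.pi * c), by positivity,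
    fun h hh hpos hint hm1 => ?_⟩
  set Λ := (μ.prod h) ⊗ₘ g with hΛ
  set m := ∫ t, t ∂h with hm
  have hm0 : 0 < m := integral_pos_of_ae_pos hpos hint
  have hae := ae_pos_compProd (μ := μ) (g := g) hpos
  have hU : ∫⁻ w, ENNReal.ofReal (fluctuation w.1.1 w.1.2 w.2) ∂Λ ≤ ENNReal.ofReal (c₁ * m) :=
    lintegral_fluctuation_le hg hμ hpos hint
  have hUm := measurable_fluctuation
  have hV : ∫⁻ w, (ENNReal.ofReal (1 + |w.1.1|) +
      ENNReal.ofReal (fluctuation w.1.1 w.1.2 w.2)) ∂Λ ≤ ENNReal.ofReal (2 * c₁) := by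
    rw [lintegral_add_left (by fun_prop)]
    have h1 : ∫⁻ w, ENNReal.ofReal (1 + |w.1.1|) ∂Λ ≤ ENNReal.ofReal c₁ := by
      rw [lintegral_true_value (f := fun t => ENNReal.ofReal (1 + |t|)) (by fun_prop)]
      have hi : Integrable (fun t : ℝ => 1 + |t|) μ := (integrable_const 1).add hμ.abs
      rw [← ofReal_integral_eq_lintegral_ofReal hi (ae_of_all _ fun t => by positivity),
        integral_add (f := fun _ => (1 : ℝ)) (g := fun t => |t|) (integrable_const 1) hμ.abs]
      refine ENNReal.ofReal_le_ofReal ?_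
      simp only [integral_const, probReal_univ, smul_eq_mul]
      linarith
    refine (add_le_add h1 (hU.trans (ENNReal.ofReal_le_ofReal
      (mul_le_of_le_one_right hc₁0 hm1)))).trans (le_of_eq ?_)
    rw [← ENNReal.ofReal_add hc₁0 hc₁0, two_mul]
  have hH : ∫⁻ z, ENNReal.ofReal
      (reversalBound C z.1.1.1 z.1.1.2 z.1.2 z.2.1.1 z.2.1.2 z.2.2) ∂Λ.prod Λ ≤
      ENNReal.ofReal ((16 * Real.pi * c * C * c₁ + 8 * Real.pi * c) * m) := by
    rw [lintegral_prod _ (measurable_reversalBound C).ennreal_ofReal.aemeasurable]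
    calc ∫⁻ w, ∫⁻ w', ENNReal.ofReal
          (reversalBound C w.1.1 w.1.2 w.2 w'.1.1 w'.1.2 w'.2) ∂Λ ∂Λ
        ≤ ∫⁻ w, (ENNReal.ofReal (8 * Real.pi * c * m) + ENNReal.ofReal (16 * Real.pi * c * C) *
            ENNReal.ofReal (fluctuation w.1.1 w.1.2 w.2)) ∂Λ := by
          refine lintegral_mono_ae ?_
          filter_upwards [hae] with w hw
          refine (lintegral_reversalBound_le hg hc hcμ hpos hint hC hw).trans (le_of_eq ?_)
          have := fluctuation_nonneg (θ := w.1.1) (x := w.2) hw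
          rw [← ENNReal.ofReal_mul (by positivity),
            ← ENNReal.ofReal_add (by positivity) (by positivity), add_comm]
      _ = ENNReal.ofReal (8 * Real.pi * c * m) + ENNReal.ofReal (16 * Real.pi * c * C) *
            ∫⁻ w, ENNReal.ofReal (fluctuation w.1.1 w.1.2 w.2) ∂Λ := by
          rw [lintegral_add_left measurable_const, lintegral_const_mul _ hUm.ennreal_ofReal]
          simp
      _ ≤ ENNReal.ofReal (8 * Real.pi * c * m) + ENNReal.ofReal (16 * Real.pi * c * C) *
            ENNReal.ofReal (c₁ * m) := by gcongr
      _ = _ := by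
          rw [← ENNReal.ofReal_mul (by positivity),
            ← ENNReal.ofReal_add (by positivity) (by positivity)]
          congr 1; ring
  have hH' : ∫⁻ z, ENNReal.ofReal
      (reversalBound C z.2.1.1 z.2.1.2 z.2.2 z.1.1.1 z.1.1.2 z.1.2) ∂Λ.prod Λ ≤
      ENNReal.ofReal ((16 * Real.pi * c * C * c₁ + 8 * Real.pi * c) * m) := by
    refine le_trans (le_of_eq ?_) hH
    exact (Measure.measurePreserving_swap (μ := Λ) (ν := Λ)).lintegral_comp
      (measurable_reversalBound C).ennreal_ofReal
  set u : (ℝ × ℝ) × ℝ → ℝ≥0∞ := fun w => ENNReal.ofReal (fluctuation w.1.1 w.1.2 w.2) with hu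
  set v : (ℝ × ℝ) × ℝ → ℝ≥0∞ := fun w => ENNReal.ofReal (1 + |w.1.1|) + u w with hv
  have hum : Measurable u := hUm.ennreal_ofReal
  have hvm : Measurable v := by fun_prop
  have hprod : (∫⁻ w, u w ∂Λ) * ∫⁻ w, v w ∂Λ ≤ ENNReal.ofReal (c₁ * (2 * c₁) * m) := by
    refine (mul_le_mul' hU hV).trans (le_of_eq ?_)
    rw [← ENNReal.ofReal_mul (by positivity)]
    congr 1; ring
  have hae2 : ∀ᵐ z ∂Λ.prod Λ, 0 < z.1.1.2 ∧ 0 < z.2.1.2 :=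
    (Measure.quasiMeasurePreserving_fst.ae hae).and (Measure.quasiMeasurePreserving_snd.ae hae)
  calc ∫⁻ z, ENNReal.ofReal (pairBound C z.1.2 z.1.1.2 z.2.2 z.2.1.2) ∂Λ.prod Λ
      ≤ ∫⁻ z, (ENNReal.ofReal (8 * C + 14) * (u z.1 * v z.2) +
          (ENNReal.ofReal (8 * C + 14) * (v z.1 * u z.2) +
          (ENNReal.ofReal (reversalBound C z.1.1.1 z.1.1.2 z.1.2 z.2.1.1 z.2.1.2 z.2.2) +
          ENNReal.ofReal (reversalBound C z.2.1.1 z.2.1.2 z.2.2 z.1.1.1 z.1.1.2 z.1.2))))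
          ∂Λ.prod Λ := by
        refine lintegral_mono_ae ?_
        filter_upwards [hae2] with z hz
        have hU1 := fluctuation_nonneg (θ := z.1.1.1) (x := z.1.2) hz.1
        have hU2 := fluctuation_nonneg (θ := z.2.1.1) (x := z.2.2) hz.2
        have hR1 := reversalBound_nonneg C z.1.1.1 z.1.1.2 z.1.2 z.2.1.1 z.2.1.2 z.2.2
        have hR2 := reversalBound_nonneg C z.2.1.1 z.2.1.2 z.2.2 z.1.1.1 z.1.1.2 z.1.2
        have hpb := pairBound_le (θ := z.1.1.1) (x := z.1.2) (θ' := z.2.1.1) (x' := z.2.2)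
          hC hz.1 hz.2
        refine (ENNReal.ofReal_le_ofReal hpb).trans (le_of_eq ?_)
        simp only [hu, hv]
        rw [← ENNReal.ofReal_add (p := 1 + |z.2.1.1|) (by positivity) hU2,
          ← ENNReal.ofReal_add (p := 1 + |z.1.1.1|) (by positivity) hU1,
          ← ENNReal.ofReal_mul hU1, ← ENNReal.ofReal_mul (p := 1 + |z.1.1.1| + _) (by positivity),
          ← ENNReal.ofReal_mul (by positivity), ← ENNReal.ofReal_mul (by positivity),
          ← ENNReal.ofReal_add hR1 hR2, ← ENNReal.ofReal_add (by positivity) (by positivity),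
          ← ENNReal.ofReal_add (by positivity) (by positivity)]
        congr 1; ring
    _ = ENNReal.ofReal (8 * C + 14) * ((∫⁻ w, u w ∂Λ) * ∫⁻ w, v w ∂Λ) +
          (ENNReal.ofReal (8 * C + 14) * ((∫⁻ w, v w ∂Λ) * ∫⁻ w, u w ∂Λ) +
          (∫⁻ z, ENNReal.ofReal
            (reversalBound C z.1.1.1 z.1.1.2 z.1.2 z.2.1.1 z.2.1.2 z.2.2) ∂Λ.prod Λ +
          ∫⁻ z, ENNReal.ofReal
            (reversalBound C z.2.1.1 z.2.1.2 z.2.2 z.1.1.1 z.1.1.2 z.1.2) ∂Λ.prod Λ)) := by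
        rw [lintegral_add_left (by fun_prop), lintegral_add_left (by fun_prop),
          lintegral_add_left (measurable_reversalBound C).ennreal_ofReal,
          lintegral_const_mul _ (by fun_prop), lintegral_const_mul _ (by fun_prop),
          lintegral_prod_mul hum.aemeasurable hvm.aemeasurable,
          lintegral_prod_mul hvm.aemeasurable hum.aemeasurable]
    _ ≤ ENNReal.ofReal (8 * C + 14) * ENNReal.ofReal (c₁ * (2 * c₁) * m) +
          (ENNReal.ofReal (8 * C + 14) * ENNReal.ofReal (c₁ * (2 * c₁) * m) +
          (ENNReal.ofReal ((16 * Real.pi * c * C * c₁ + 8 * Real.pi * c) * m) +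
          ENNReal.ofReal ((16 * Real.pi * c * C * c₁ + 8 * Real.pi * c) * m))) := by
        gcongr
        rw [mul_comm]
        exact hprod
    _ = _ := by
        rw [← ENNReal.ofReal_mul (by positivity),
          ← ENNReal.ofReal_add (p := (16 * Real.pi * c * C * c₁ + 8 * Real.pi * c) * m)
            (by positivity) (by positivity),
          ← ENNReal.ofReal_add (by positivity) (by positivity),
          ← ENNReal.ofReal_add (by positivity) (by positivity)]
        congr 1; ring

/-- The expectation of the bound for the loss of one pair, at the scale `η`. -/
theorem exists_lintegral_pair_le {μ : Measure ℝ} [IsProbabilityMeasure μ]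
    {g : Kernel (ℝ × ℝ) ℝ} [IsMarkovKernel g] {ν : Measure ℝ}
    {L : ℝ → ℝ → ℝ → ℝ} (hg : IsErrorModel g ν L) (hμd : HasBoundedDensity μ)
    (hμ2 : MemLp id 2 μ) {C : ℝ} (hC : 1 ≤ C) :
    ∃ B : ℝ, 0 ≤ B ∧ ∀ h : Measure ℝ, IsProbabilityMeasure h → (∀ᵐ t ∂h, 0 < t) →
      Integrable id h → ∫ t, t ∂h ≤ 1 → ∀ η, 0 < η →
      ∫⁻ z, ((if |z.2.1.1 - z.1.1.1| < η then 1 else 0) +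
          ENNReal.ofReal (η * (z.2.1.1 - z.1.1.1) ^ 2) + ENNReal.ofReal (1 / η) *
          (ENNReal.ofReal (fluctuation z.1.1.1 z.1.1.2 z.1.2 + fluctuation z.2.1.1 z.2.1.2 z.2.2) +
            ENNReal.ofReal (pairBound C z.1.2 z.1.1.2 z.2.2 z.2.1.2)))
          ∂((μ.prod h) ⊗ₘ g).prod ((μ.prod h) ⊗ₘ g) ≤
        ENNReal.ofReal (B * (η + 1 / η * ∫ t, t ∂h)) := by
  have hμ : Integrable id μ := hμ2.integrable one_le_two
  obtain ⟨B, hB, hpair⟩ := exists_lintegral_pairBound_le hg hμd hμ hC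
  obtain ⟨c, hc, hcμ⟩ := hμd.exists_lintegral_le
  set c₁ := 2 + ∫ t, |t| ∂μ with hc₁
  set c₂ := ∫ t, t ^ 2 ∂μ with hc₂
  have hμ0 : 0 ≤ ∫ t, |t| ∂μ := integral_nonneg fun t => abs_nonneg t
  have hc₁0 : 0 ≤ c₁ := by positivity
  have hc₂0 : 0 ≤ c₂ := integral_nonneg fun t => sq_nonneg t
  refine ⟨2 * c + 4 * c₂ + (2 * c₁ + B), by positivity, fun h hh hpos hint hm1 η hη => ?_⟩
  have hpair := hpair h hh hpos hint hm1
  set Λ := (μ.prod h) ⊗ₘ g with hΛ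
  set m := ∫ t, t ∂h with hm
  have hm0 : 0 < m := integral_pos_of_ae_pos hpos hint
  have hU : ∫⁻ w, ENNReal.ofReal (fluctuation w.1.1 w.1.2 w.2) ∂Λ ≤ ENNReal.ofReal (c₁ * m) :=
    lintegral_fluctuation_le hg hμ hpos hint
  have hUm := measurable_fluctuation
  have hind : Measurable fun z : ((ℝ × ℝ) × ℝ) × ((ℝ × ℝ) × ℝ) =>
      if |z.2.1.1 - z.1.1.1| < η then (1 : ℝ≥0∞) else 0 :=
    Measurable.ite (measurableSet_lt (by fun_prop) measurable_const) measurable_const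
      measurable_const
  have h1 : ∫⁻ z, (if |z.2.1.1 - z.1.1.1| < η then 1 else 0) ∂Λ.prod Λ ≤
      ENNReal.ofReal (2 * c * η) := by
    rw [lintegral_prod _ hind.aemeasurable]
    calc ∫⁻ w, ∫⁻ w', (if |w'.1.1 - w.1.1| < η then 1 else 0) ∂Λ ∂Λ
        ≤ ∫⁻ _, ENNReal.ofReal (2 * c * η) ∂Λ := by
          refine lintegral_mono fun w => ?_
          have hb : (fun t => if |t - w.1.1| < η then (1 : ℝ≥0∞) else 0) =
              (Metric.ball w.1.1 η).indicator 1 := by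
            funext t
            by_cases ht : |t - w.1.1| < η
            · rw [if_pos ht, Set.indicator_of_mem (by rwa [Metric.mem_ball, Real.dist_eq])]
              rfl
            · rw [if_neg ht, Set.indicator_of_notMem (by rwa [Metric.mem_ball, Real.dist_eq])]
          rw [lintegral_true_value (f := fun t => if |t - w.1.1| < η then (1 : ℝ≥0∞) else 0)
            (by rw [hb]; exact measurable_one.indicator measurableSet_ball)]
          refine (hcμ _).trans (le_of_eq ?_)
          rw [hb, lintegral_indicator_one measurableSet_ball, Real.volume_ball,
            ← ENNReal.ofReal_mul hc]
          congr 1; ring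
      _ = _ := by simp
  have h2 : ∫⁻ z, ENNReal.ofReal (η * (z.2.1.1 - z.1.1.1) ^ 2) ∂Λ.prod Λ ≤
      ENNReal.ofReal (4 * c₂ * η) := by
    have hsq : ∫⁻ w, ENNReal.ofReal (w.1.1 ^ 2) ∂Λ = ENNReal.ofReal c₂ := by
      rw [lintegral_true_value (f := fun t => ENNReal.ofReal (t ^ 2)) (by fun_prop)]
      exact (ofReal_integral_eq_lintegral_ofReal hμ2.integrable_sq
        (ae_of_all _ fun t => sq_nonneg _)).symm
    calc ∫⁻ z, ENNReal.ofReal (η * (z.2.1.1 - z.1.1.1) ^ 2) ∂Λ.prod Λ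
        ≤ ∫⁻ z, (ENNReal.ofReal (2 * η) * ENNReal.ofReal (z.1.1.1 ^ 2) +
            ENNReal.ofReal (2 * η) * ENNReal.ofReal (z.2.1.1 ^ 2)) ∂Λ.prod Λ := by
          refine lintegral_mono fun z => ?_
          rw [← ENNReal.ofReal_mul (by positivity), ← ENNReal.ofReal_mul (by positivity),
            ← ENNReal.ofReal_add (by positivity) (by positivity)]
          refine ENNReal.ofReal_le_ofReal ?_
          nlinarith [mul_nonneg hη.le (sq_nonneg (z.2.1.1 + z.1.1.1))]
      _ = ENNReal.ofReal (2 * η) * ENNReal.ofReal c₂ +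
            ENNReal.ofReal (2 * η) * ENNReal.ofReal c₂ := by
          rw [lintegral_add_left (by fun_prop), lintegral_const_mul _ (by fun_prop),
            lintegral_const_mul _ (by fun_prop),
            lintegral_prod_fst (f := fun w : (ℝ × ℝ) × ℝ => ENNReal.ofReal (w.1.1 ^ 2))
              (by fun_prop),
            lintegral_prod_snd (f := fun w : (ℝ × ℝ) × ℝ => ENNReal.ofReal (w.1.1 ^ 2))
              (by fun_prop), hsq]
      _ = _ := by
          rw [← ENNReal.ofReal_mul (by positivity),
            ← ENNReal.ofReal_add (by positivity) (by positivity)]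
          congr 1; ring
  have h3 : ∫⁻ z, ENNReal.ofReal
      (fluctuation z.1.1.1 z.1.1.2 z.1.2 + fluctuation z.2.1.1 z.2.1.2 z.2.2) ∂Λ.prod Λ ≤
      ENNReal.ofReal (2 * c₁ * m) := by
    calc ∫⁻ z, ENNReal.ofReal
          (fluctuation z.1.1.1 z.1.1.2 z.1.2 + fluctuation z.2.1.1 z.2.1.2 z.2.2) ∂Λ.prod Λ
        ≤ ∫⁻ z, (ENNReal.ofReal (fluctuation z.1.1.1 z.1.1.2 z.1.2) +
            ENNReal.ofReal (fluctuation z.2.1.1 z.2.1.2 z.2.2)) ∂Λ.prod Λ :=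
          lintegral_mono fun z => ENNReal.ofReal_add_le
      _ = ∫⁻ w, ENNReal.ofReal (fluctuation w.1.1 w.1.2 w.2) ∂Λ +
            ∫⁻ w, ENNReal.ofReal (fluctuation w.1.1 w.1.2 w.2) ∂Λ := by
          have hU1 : Measurable fun z : ((ℝ × ℝ) × ℝ) × ((ℝ × ℝ) × ℝ) =>
              ENNReal.ofReal (fluctuation z.1.1.1 z.1.1.2 z.1.2) :=
            hUm.ennreal_ofReal.comp measurable_fst
          rw [lintegral_add_left hU1,
            lintegral_prod_fst hUm.ennreal_ofReal, lintegral_prod_snd hUm.ennreal_ofReal]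
      _ ≤ ENNReal.ofReal (c₁ * m) + ENNReal.ofReal (c₁ * m) := add_le_add hU hU
      _ = _ := by
          rw [← ENNReal.ofReal_add (by positivity) (by positivity)]
          congr 1; ring
  have hm3 : Measurable fun z : ((ℝ × ℝ) × ℝ) × ((ℝ × ℝ) × ℝ) => ENNReal.ofReal
      (fluctuation z.1.1.1 z.1.1.2 z.1.2 + fluctuation z.2.1.1 z.2.1.2 z.2.2) :=
    ((hUm.comp measurable_fst).add (hUm.comp measurable_snd)).ennreal_ofReal
  have hm4 := (measurable_pairBound C).ennreal_ofReal
  have hm2 : Measurable fun z : ((ℝ × ℝ) × ℝ) × ((ℝ × ℝ) × ℝ) =>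
      (if |z.2.1.1 - z.1.1.1| < η then (1 : ℝ≥0∞) else 0) +
        ENNReal.ofReal (η * (z.2.1.1 - z.1.1.1) ^ 2) := hind.add (by fun_prop)
  rw [lintegral_add_left hm2, lintegral_add_left hind, lintegral_const_mul' _ _ (by simp),
    lintegral_add_left hm3]
  calc _ ≤ ENNReal.ofReal (2 * c * η) + ENNReal.ofReal (4 * c₂ * η) + ENNReal.ofReal (1 / η) *
        (ENNReal.ofReal (2 * c₁ * m) + ENNReal.ofReal (B * m)) := by gcongr
    _ = ENNReal.ofReal ((2 * c + 4 * c₂) * η + (2 * c₁ + B) * (1 / η * m)) := by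
        rw [← ENNReal.ofReal_add (p := 2 * c * η) (by positivity) (by positivity),
          ← ENNReal.ofReal_add (p := 2 * c₁ * m) (by positivity) (by positivity),
          ← ENNReal.ofReal_mul (by positivity),
          ← ENNReal.ofReal_add (by positivity) (by positivity)]
        congr 1; ring
    _ ≤ _ := by
        refine ENNReal.ofReal_le_ofReal ?_
        have p1 : 0 ≤ (2 * c + 4 * c₂) * (1 / η * m) := by positivity
        have p2 : 0 ≤ (2 * c₁ + B) * η := by positivity
        nlinarith

/-! ### Consistency -/

/-- Two different units of a ranking sample are independent. -/
theorem IsRankingSample.lintegral_pair {Ω : Type*} [MeasurableSpace Ω] {P : Measure Ω}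
    [IsProbabilityMeasure P] {μ : Measure ℝ} {h : ℕ → Measure ℝ}
    {g : Kernel (ℝ × ℝ) ℝ} {Θ : ℕ → Ω → ℝ} {σ X : (p : ℕ) → Fin p → Ω → ℝ}
    (hdata : IsRankingSample P μ h g Θ σ X) {p : ℕ} {i j : Fin p} (hij : j ≠ i)
    {F : ((ℝ × ℝ) × ℝ) × ((ℝ × ℝ) × ℝ) → ℝ≥0∞} (hF : Measurable F) :
    ∫⁻ ω, F (((Θ i ω, σ p i ω), X p i ω), ((Θ j ω, σ p j ω), X p j ω)) ∂P =
      ∫⁻ z, F z ∂((μ.prod (h p)) ⊗ₘ g).prod ((μ.prod (h p)) ⊗ₘ g) := by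
  have hm : ∀ k : Fin p, Measurable fun ω => ((Θ k ω, σ p k ω), X p k ω) := fun k =>
    ((hdata.measurable_Θ k).prodMk (hdata.measurable_σ p k)).prodMk (hdata.measurable_X p k)
  have hmap := (indepFun_iff_map_prod_eq_prod_map_map (hm i).aemeasurable (hm j).aemeasurable).1
    ((hdata.indep p).indepFun hij.symm)
  rw [hdata.law p i, hdata.law p j] at hmap
  rw [← hmap, lintegral_map hF ((hm i).prodMk (hm j))]

theorem IsRankingSample.ae_pos {Ω : Type*} [MeasurableSpace Ω] {P : Measure Ω}
    {μ : Measure ℝ} [IsProbabilityMeasure μ] {h : ℕ → Measure ℝ}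
    [∀ p, IsProbabilityMeasure (h p)] {g : Kernel (ℝ × ℝ) ℝ} [IsMarkovKernel g]
    {Θ : ℕ → Ω → ℝ} {σ X : (p : ℕ) → Fin p → Ω → ℝ}
    (hdata : IsRankingSample P μ h g Θ σ X) (hpos : ∀ p, ∀ᵐ t ∂h p, 0 < t) (p : ℕ) :
    ∀ᵐ ω ∂P, ∀ i, 0 < σ p i ω := by
  rw [ae_all_iff]
  intro i
  have hm : Measurable fun ω => ((Θ i ω, σ p i ω), X p i ω) :=
    ((hdata.measurable_Θ i).prodMk (hdata.measurable_σ p i)).prodMk (hdata.measurable_X p i)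
  have := ae_pos_compProd (μ := μ) (g := g) (hpos p)
  rw [← hdata.law p i] at this
  exact ae_of_ae_map hm.aemeasurable this

theorem sum_offDiag_le {p : ℕ} {f : Fin p → Fin p → ℝ≥0∞} {b : ℝ≥0∞}
    (h : ∀ i j, j ≠ i → f i j ≤ b) : ∑ i, ∑ j with j ≠ i, f i j ≤ p * p * b := by
  calc ∑ i, ∑ j with j ≠ i, f i j ≤ ∑ _i : Fin p, ∑ _j : Fin p, b := by
        refine Finset.sum_le_sum fun i _ => ?_
        refine (Finset.sum_le_sum fun j hj => h i j (Finset.mem_filter.1 hj).2).trans ?_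
        exact Finset.sum_le_sum_of_subset (Finset.filter_subset _ _)
    _ = _ := by simp [mul_assoc]

/-- Without any information on the ranking, the expected loss of a pair is bounded. -/
theorem IsRankingSample.exists_lintegral_loss_le_of_restrained {Ω : Type*} [MeasurableSpace Ω]
    {P : Measure Ω} [IsProbabilityMeasure P] {μ : Measure ℝ} [IsProbabilityMeasure μ]
    {h : ℕ → Measure ℝ} [∀ p, IsProbabilityMeasure (h p)]
    {g : Kernel (ℝ × ℝ) ℝ} [IsMarkovKernel g] {Θ : ℕ → Ω → ℝ} {σ X : (p : ℕ) → Fin p → Ω → ℝ}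
    (hdata : IsRankingSample P μ h g Θ σ X) (hμ : Integrable id μ)
    {l : ℝ → ℝ → ℝ} (hl : IsPairwiseLoss l) (hlr : Restrained l) :
    ∃ B : ℝ, 0 ≤ B ∧ ∀ p, ∀ e : Ω → Equiv.Perm (Fin p),
      ∫⁻ ω, ∑ k, ∑ j ∈ Finset.Ioi k,
        ENNReal.ofReal (l (Θ (e ω k) ω) (Θ (e ω j) ω)) ∂P ≤ p * p * ENNReal.ofReal B := by
  obtain ⟨c₀, hc₀, hup⟩ := hlr.exists_upper_bound
  have hμ0 : 0 ≤ ∫ t, |t| ∂μ := integral_nonneg fun t => abs_nonneg t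
  refine ⟨c₀ * (1 + 2 * ∫ t, |t| ∂μ), by positivity, fun p e => ?_⟩
  set f : Ω → Fin p → Fin p → ℝ≥0∞ := fun ω i j =>
    ENNReal.ofReal c₀ * (1 + ENNReal.ofReal |Θ i ω| + ENNReal.ofReal |Θ j ω|) with hf
  have hΘ := hdata.measurable_Θ
  have hfm : ∀ i j, Measurable fun ω => f ω i j := fun i j => by
    have h1 := hΘ i
    have h2 := hΘ j
    fun_prop
  have hE : ∀ i : Fin p, ∫⁻ ω, ENNReal.ofReal |Θ i ω| ∂P = ENNReal.ofReal (∫ t, |t| ∂μ) := by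
    intro i
    have hm : Measurable fun ω => ((Θ i ω, σ p i ω), X p i ω) :=
      ((hdata.measurable_Θ i).prodMk (hdata.measurable_σ p i)).prodMk (hdata.measurable_X p i)
    have h1 := lintegral_true_value (μ := μ) (h := h p) (g := g)
      (f := fun t => ENNReal.ofReal |t|) (by fun_prop)
    rw [← hdata.law p i, lintegral_map (by fun_prop) hm] at h1
    rw [h1]
    exact (ofReal_integral_eq_lintegral_ofReal hμ.abs (ae_of_all _ fun t => abs_nonneg _)).symm
  calc ∫⁻ ω, ∑ k, ∑ j ∈ Finset.Ioi k,
        ENNReal.ofReal (l (Θ (e ω k) ω) (Θ (e ω j) ω)) ∂P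
      ≤ ∫⁻ ω, ∑ i, ∑ j with j ≠ i, f ω i j ∂P := by
        refine lintegral_mono fun ω => ?_
        refine le_trans ?_ (sum_ranked_pairs_le (e ω) (f ω))
        refine Finset.sum_le_sum fun k _ => Finset.sum_le_sum fun j _ => ?_
        rcases le_or_gt (Θ (e ω j) ω) (Θ (e ω k) ω) with hlt | hlt
        · rw [hl.1 _ _ hlt]; simp
        · refine (ENNReal.ofReal_le_ofReal (hup _ _ hlt)).trans ?_
          rw [ENNReal.ofReal_mul hc₀.le, hf]
          refine mul_le_mul_right ?_ _
          rw [← ENNReal.ofReal_one, ← ENNReal.ofReal_add zero_le_one (abs_nonneg _),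
            ← ENNReal.ofReal_add (by positivity) (abs_nonneg _)]
          refine ENNReal.ofReal_le_ofReal ?_
          linarith [neg_abs_le (Θ (e ω k) ω), le_abs_self (Θ (e ω j) ω)]
    _ = ∑ i, ∑ j with j ≠ i, ∫⁻ ω, f ω i j ∂P := by
        rw [lintegral_finsetSum _ fun i _ => Finset.measurable_sum _ fun j _ => hfm i j]
        refine Finset.sum_congr rfl fun i _ => ?_
        rw [lintegral_finsetSum _ fun j _ => hfm i j]
    _ ≤ _ := by
        refine sum_offDiag_le fun i j _ => le_of_eq ?_
        have h1 := hΘ i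
        have h2 := hΘ j
        simp only [hf]
        rw [lintegral_const_mul _ (by fun_prop), lintegral_add_left (by fun_prop),
          lintegral_add_left measurable_const, hE, hE, lintegral_const, measure_univ, mul_one,
          ENNReal.ofReal_mul hc₀.le, ENNReal.ofReal_add zero_le_one (by positivity),
          ENNReal.ofReal_one, two_mul, ENNReal.ofReal_add hμ0 hμ0, add_assoc]

end Ranking


theorem mainTheorem1 {Ω : Type*} [MeasurableSpace Ω] (P : Measure Ω) [IsProbabilityMeasure P]
    -- the true distribution, the laws of the standard deviations, the error distribution
    (μ : Measure ℝ) [IsProbabilityMeasure μ]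
    (h : ℕ → Measure ℝ) [∀ p, IsProbabilityMeasure (h p)]
    (g : Kernel (ℝ × ℝ) ℝ) [IsMarkovKernel g]
    (ν : Measure ℝ) [SigmaFinite ν] (L : ℝ → ℝ → ℝ → ℝ)
    (hμ_density : Ranking.HasBoundedDensity μ) (hμ_moment : MemLp id 2 μ)
    (hh_pos : ∀ p, ∀ᵐ t ∂h p, 0 < t) (hh_mean : ∀ p, Integrable id (h p))
    (hg : Ranking.IsErrorModel g ν L) (hL : Ranking.RegularLikelihood L)
    -- the data
    (Θ : ℕ → Ω → ℝ) (σ X : (p : ℕ) → Fin p → Ω → ℝ)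
    (hdata : Ranking.IsRankingSample P μ h g Θ σ X)
    -- the estimating prior density, possibly improper
    (π : ℝ → ℝ) (hπ_meas : Measurable π) (hπ_nonneg : ∀ θ, 0 ≤ π θ)
    (hπ_quasi : Ranking.Quasiunimodal π) (hπ_tail : Ranking.TailDominating π L)
    -- the loss of the ranking method, and the ranking method
    (s' : ℕ → ℝ) (R : (p : ℕ) → (Fin p → ℝ) → ℝ) (hR : Ranking.RegularLoss s' R)
    (ρ : (p : ℕ) → (Fin p → ℝ) → (Fin p → ℝ) → Equiv.Perm (Fin p))
    (hρ : Ranking.IsBayesianRanking π L R ρ)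
    -- the loss with respect to which consistency is claimed
    (s : ℕ → ℝ) (M : (p : ℕ) → (Fin p → ℝ) → ℝ) (hM : Ranking.RegularLoss s M)
    (hs : Tendsto (fun p : ℕ => s p * (p : ℝ) ^ 2 * (∫ t, t ∂h p) ^ (1 / 3 : ℝ)) atTop (𝓝 0)) :
    Ranking.Consistent P Θ σ X M ρ := by
  obtain ⟨C, hC, hq⟩ := Ranking.exists_concentrated_posterior hg.measurable hg.nonneg hL hπ_meas
    hπ_nonneg hπ_quasi hπ_tail
  obtain ⟨hs0, -, l, hl, hlr, c, u, hc, hcu, heq⟩ := hM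
  obtain ⟨B₁, hB₁, hsum⟩ := hρ.sum_loss_le hR hC hq hl hlr
  obtain ⟨B₂, hB₂, hpair⟩ := Ranking.exists_lintegral_pair_le hg hμ_density hμ_moment hC
  obtain ⟨B₃, hB₃, htriv⟩ := hdata.exists_lintegral_loss_le_of_restrained
    (hμ_moment.integrable one_le_two) hl hlr
  set K := 2 * B₁ * B₂ + B₃ with hK
  have hK0 : 0 ≤ K := by positivity
  -- The expected additive loss per pair is of the order of the cube root of the mean of `σ`.
  have hadd : ∀ p, 1 ≤ p → ∫⁻ ω, ∑ k, ∑ j ∈ Finset.Ioi k, ENNReal.ofReal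
      (l (Θ ((ρ p (fun i => X p i ω) (fun i => σ p i ω)).symm k) ω)
        (Θ ((ρ p (fun i => X p i ω) (fun i => σ p i ω)).symm j) ω)) ∂P ≤
      p * p * ENNReal.ofReal (K * (∫ t, t ∂h p) ^ (1 / 3 : ℝ)) := by
    intro p hp
    have hm0 : 0 < ∫ t, t ∂h p := Ranking.integral_pos_of_ae_pos (hh_pos p) (hh_mean p)
    set m := ∫ t, t ∂h p with hm
    -- This choice makes `m / η = η ^ 2`, which is at most `η` if `m ≤ 1`.
    set η := m ^ (1 / 3 : ℝ) with hη
    have hη0 : 0 < η := Real.rpow_pos_of_pos hm0 _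
    have hη3 : η ^ 3 = m := by
      rw [hη, ← Real.rpow_natCast, ← Real.rpow_mul hm0.le]
      norm_num
    rcases le_or_gt m 1 with hm1 | hm1
    · have hη1 : η ≤ 1 := Real.rpow_le_one hm0.le hm1 (by norm_num)
      set T : ((ℝ × ℝ) × ℝ) × ((ℝ × ℝ) × ℝ) → ℝ≥0∞ := fun z =>
        (if |z.2.1.1 - z.1.1.1| < η then 1 else 0) +
          ENNReal.ofReal (η * (z.2.1.1 - z.1.1.1) ^ 2) + ENNReal.ofReal (1 / η) *
          (ENNReal.ofReal (Ranking.fluctuation z.1.1.1 z.1.1.2 z.1.2 +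
            Ranking.fluctuation z.2.1.1 z.2.1.2 z.2.2) +
            ENNReal.ofReal (Ranking.pairBound C z.1.2 z.1.1.2 z.2.2 z.2.1.2)) with hT
      have hTm : Measurable T := by
        have h1 := Ranking.measurable_fluctuation
        have h2 := (Ranking.measurable_pairBound C).ennreal_ofReal
        refine (Measurable.add (Measurable.ite (measurableSet_lt (by fun_prop) measurable_const)
          measurable_const measurable_const) (by fun_prop)).add (Measurable.const_mul
          (Measurable.add ?_ h2) _)
        exact ((h1.comp measurable_fst).add (h1.comp measurable_snd)).ennreal_ofReal
      have hTint := hpair (h p) inferInstance (hh_pos p) (hh_mean p) hm1 η hη0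
      have hTp : ∀ i j : Fin p, j ≠ i →
          ∫⁻ ω, T (((Θ i ω, σ p i ω), X p i ω), ((Θ j ω, σ p j ω), X p j ω)) ∂P ≤
            ENNReal.ofReal (B₂ * (2 * η)) := by
        intro i j hij
        rw [hdata.lintegral_pair hij hTm]
        refine hTint.trans (ENNReal.ofReal_le_ofReal ?_)
        refine mul_le_mul_of_nonneg_left ?_ hB₂
        have e : 1 / η * m = η ^ 2 := by rw [← hη3]; field_simp
        rw [← hm, e]
        nlinarith
      have hTm' : ∀ i j : Fin p, Measurable fun ω =>
          T (((Θ i ω, σ p i ω), X p i ω), ((Θ j ω, σ p j ω), X p j ω)) := fun i j =>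
        hTm.comp ((((hdata.measurable_Θ i).prodMk (hdata.measurable_σ p i)).prodMk
          (hdata.measurable_X p i)).prodMk (((hdata.measurable_Θ j).prodMk
          (hdata.measurable_σ p j)).prodMk (hdata.measurable_X p j)))
      calc _ ≤ ∫⁻ ω, ENNReal.ofReal B₁ * ∑ i : Fin p, ∑ j : Fin p with j ≠ i,
            T (((Θ i ω, σ p i ω), X p i ω), ((Θ j ω, σ p j ω), X p j ω)) ∂P := by
            refine lintegral_mono_ae ?_
            filter_upwards [hdata.ae_pos hh_pos p] with ω hω
            exact hsum η hη0 hη1 p hp (fun i => Θ i ω) (fun i => X p i ω) (fun i => σ p i ω) hω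
        _ = ENNReal.ofReal B₁ * ∑ i : Fin p, ∑ j : Fin p with j ≠ i,
            ∫⁻ ω, T (((Θ i ω, σ p i ω), X p i ω), ((Θ j ω, σ p j ω), X p j ω)) ∂P := by
            rw [lintegral_const_mul' _ _ (by simp), lintegral_finsetSum _
              fun i _ => Finset.measurable_sum _ fun j _ => hTm' i j]
            congr 1
            refine Finset.sum_congr rfl fun i _ => ?_
            rw [lintegral_finsetSum _ fun j _ => hTm' i j]
        _ ≤ ENNReal.ofReal B₁ * (p * p * ENNReal.ofReal (B₂ * (2 * η))) :=
            mul_le_mul_right (Ranking.sum_offDiag_le hTp) _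
        _ = p * p * ENNReal.ofReal (2 * B₁ * B₂ * η) := by
            rw [mul_left_comm, ← ENNReal.ofReal_mul hB₁.le]
            congr 2; ring
        _ ≤ _ := by
            gcongr
            linarith
    · refine (htriv p fun ω => (ρ p (fun i => X p i ω) (fun i => σ p i ω)).symm).trans ?_
      gcongr
      have hη1 : 1 ≤ η := Real.one_le_rpow hm1.le (by norm_num)
      have : B₃ * 1 ≤ K * η := by
        gcongr
        have : 0 ≤ 2 * B₁ * B₂ := by positivity
        linarith
      linarith
  have hlim : Tendsto (fun p : ℕ => ENNReal.ofReal
      (K / c * (s p * (p : ℝ) ^ 2 * (∫ t, t ∂h p) ^ (1 / 3 : ℝ)))) atTop (𝓝 0) := by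
    have := ENNReal.tendsto_ofReal (hs.const_mul (K / c))
    rwa [mul_zero, ENNReal.ofReal_zero] at this
  refine tendsto_of_tendsto_of_tendsto_of_le_of_le' tendsto_const_nhds hlim
    (Eventually.of_forall fun p => zero_le) ?_
  filter_upwards [eventually_ge_atTop 1] with p hp
  have hsp := hs0 p hp
  have hm0 : 0 < ∫ t, t ∂h p := Ranking.integral_pos_of_ae_pos (hh_pos p) (hh_mean p)
  calc ∫⁻ ω, ENNReal.ofReal
        (M p fun k => Θ ((ρ p (fun i => X p i ω) (fun i => σ p i ω)).symm k) ω) ∂P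
      ≤ ∫⁻ ω, ENNReal.ofReal (s p / c) * ∑ k, ∑ j ∈ Finset.Ioi k, ENNReal.ofReal
        (l (Θ ((ρ p (fun i => X p i ω) (fun i => σ p i ω)).symm k) ω)
          (Θ ((ρ p (fun i => X p i ω) (fun i => σ p i ω)).symm j) ω)) ∂P :=
        lintegral_mono fun ω => Ranking.ofReal_le_of_le_additiveLoss hl hc hsp (heq p hp _).1
    _ ≤ ENNReal.ofReal (s p / c) *
        (p * p * ENNReal.ofReal (K * (∫ t, t ∂h p) ^ (1 / 3 : ℝ))) := by
        rw [lintegral_const_mul' _ _ (by simp)]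
        exact mul_le_mul_right (hadd p hp) _
    _ = _ := by
        have hr : 0 ≤ (∫ t, t ∂h p) ^ (1 / 3 : ℝ) := Real.rpow_nonneg hm0.le _
        rw [← ENNReal.ofReal_natCast p, ← ENNReal.ofReal_mul (by positivity),
          ← ENNReal.ofReal_mul (by positivity), ← ENNReal.ofReal_mul (by positivity)]
        congr 1
        field_simp
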